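/- Let $0<\alpha\le 1$, $0<\beta\le 1$, and let $a,b$ be nonzero real numbers. For $t>0$ the conformable derivative of order $\alpha$ is $D^{\alpha}f(t)=\lim_{\varepsilon\to0}\frac{f(t+\varepsilon t^{1-\alpha})-f(t)}{\varepsilon}$; write $u_t^{(\beta)}$ and $u_x^{(\alpha)}$ for the partial conformable derivatives of $u(t,x)$ and $u_x^{(2\alpha)}=(u_x^{(\alpha)})_x^{(\alpha)}$. Consider the fractional modified Burgers equation $$u_t^{(\beta)}+a\,u^2u_x^{(\alpha)}+b\,u_x^{(2\alpha)}=0\qquad(t>0,\ x>0).\tag{1}$$ Let $\Omega\subseteq\{(t,x,u)\in\mathbb R^3: t>0,\ x>0\}$ be open, connected and nonempty (for instance the whole set), and let $V=\tau\,\partial_t+\xi\,\partial_x+\eta\,\partial_u$ be a vector field on $\Omega$. (i) Say that $V$ generates Lie point symmetries of (1) if $V$ is smooth and near every point of $\Omega$ there is a smooth local one-parameter family $\Phi_\varepsilon$ of point transformations, $|\varepsilon|<\delta$, with $\frac{d}{d\varepsilon}\Phi_\varepsilon=V(\Phi_\varepsilon)$ and $\Phi_0=\mathrm{id}$, such that each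 $\Phi_\varepsilon$ maps smooth solutions of (1) to solutions (whenever the image of the graph of a solution is the graph of a smooth function, this function is a solution). This holds if and only if there are constants $c_1,c_2,c_3\in\mathbb R$ such that on $\Omega$ $$\tau=-\frac{4c_1t}{\beta}+c_2t^{1-\beta},\qquad \xi=-\frac{2c_1x}{\alpha}+c_3x^{1-\alpha},\qquad \eta=c_1u.\tag{2}$$ (ii) Likewise, a smooth $V$ satisfies the Lie symmetry condition $\mathrm{pr}V(\Delta)=0$ at all jets over $\Omega$ with $\Delta=0$ if and only if it is of the form (2) on $\Omega$. Here $$\Delta=t^{1-\beta}u_t+a\,u^2x^{1-\alpha}u_x+b\left(x^{2-2\alpha}u_{xx}+(1-\alpha)x^{1-2\alpha}u_x\right)$$ is the left-hand side of (1) in ordinary derivatives, and $\mathrm{pr}V=V+\eta^t\partial_{u_t}+\eta^x\partial_{u_x}+\eta^{xx}\partial_{u_{xx}}$ with $\eta^t=D_t\eta-u_xD_t\xi-u_tD_t\tau$, $\eta^x=D_x\eta-u_xD_x\xi-u_tD_x\tau$, $\eta^{xx}=D_x\eta^x-u_{xx}D_x\xi-u_{xt}D_x\tau$, where $D_t,D_x$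 are the total derivatives. (iii) The vector fields generating Lie point symmetries of (1) on $\Omega$ form a three-dimensional real Lie algebra under the commutator, with basis $$V_1=t^{1-\beta}\partial_t,\qquad V_2=x^{1-\alpha}\partial_x,\qquad V_3=\frac{4t}{\beta}\partial_t+\frac{2x}{\alpha}\partial_x-u\,\partial_u,$$ and commutation relations $[V_1,V_2]=0$, $[V_1,V_3]=4V_1$, $[V_2,V_3]=2V_2$. -/

import Mathlib

open Set Filter Topology
open scoped ContDiff

noncomputable section

namespace ConformableBurgers

/-- The conformable fractional derivative of order `α` of `f` at a point `t > 0`: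
`lim_{ε → 0} (f (t + ε t^(1-α)) - f t) / ε`. -/
def confDeriv (α : ℝ) (f : ℝ → ℝ) (t : ℝ) : ℝ :=
  limUnder (𝓝[≠] (0 : ℝ)) fun ε : ℝ => (f (t + ε * t ^ (1 - α)) - f t) / ε

/-- `u = u(t, x)` is a smooth solution, on the set `D` of points `(t, x)`, of
`∂^β u/∂t^β + a u² ∂^α u/∂x^α + b ∂^{2α} u/∂x^{2α} = 0`,
the last term being the sequential derivative. It is used for open `D` inside `t > 0`, `x > 0`,
where all the limits exist by smoothness. -/
def IsSolutionOn (α β a b : ℝ) (D : Set (ℝ × ℝ)) (u : ℝ × ℝ → ℝ) : Prop :=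
  ContDiffOn ℝ ∞ u D ∧
    ∀ t x : ℝ, (t, x) ∈ D →
      confDeriv β (fun s => u (s, x)) t
        + a * u (t, x) ^ 2 * confDeriv α (fun y => u (t, y)) x
        + b * confDeriv α (fun y => confDeriv α (fun z => u (t, z)) y) x = 0

/-- The graph `{(t, x, u(t, x)) : (t, x) ∈ D}`. -/
def graphOver (D : Set (ℝ × ℝ)) (u : ℝ × ℝ → ℝ) : Set (ℝ × ℝ × ℝ) :=
  (fun q : ℝ × ℝ => (q.1, q.2, u q)) '' D

/-- The point transformation `Ψ`, defined on the set `N` of points `(t, x, u)`, maps solutions to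
solutions: if `u` is a solution whose graph lies in `N`, and `Ψ` carries this graph onto the graph
of a smooth function `û`, then `û` is a solution. -/
def MapsSolutions (α β a b : ℝ) (N : Set (ℝ × ℝ × ℝ)) (Ψ : ℝ × ℝ × ℝ → ℝ × ℝ × ℝ) : Prop :=
  ∀ (D : Set (ℝ × ℝ)) (u : ℝ × ℝ → ℝ) (D' : Set (ℝ × ℝ)) (u' : ℝ × ℝ → ℝ),
    IsOpen D → IsSolutionOn α β a b D u → graphOver D u ⊆ N →
    IsOpen D' → ContDiffOn ℝ ∞ u' D' → graphOver D' u' = Ψ '' graphOver D u →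
    IsSolutionOn α β a b D' u'

/-- The smooth vector field `V = (τ, ξ, η)`, that is `τ ∂_t + ξ ∂_x + η ∂_u`, on `Ω` generates a
local one-parameter group of symmetries of the equation: near every point of `Ω` there is a smooth
family of transformations `Φ ε`, `|ε| < δ`, which solves the Lie equations
`dΦ/dε = V (Φ)`, `Φ 0 = id`, and each of which maps solutions to solutions. -/
def GeneratesSymmetries (α β a b : ℝ) (Ω : Set (ℝ × ℝ × ℝ))
    (V : ℝ × ℝ × ℝ → ℝ × ℝ × ℝ) : Prop :=
  ContDiffOn ℝ ∞ V Ω ∧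
    ∀ p ∈ Ω, ∃ δ > (0 : ℝ), ∃ N : Set (ℝ × ℝ × ℝ), IsOpen N ∧ p ∈ N ∧ N ⊆ Ω ∧
      ∃ Φ : ℝ → ℝ × ℝ × ℝ → ℝ × ℝ × ℝ,
        ContDiffOn ℝ ∞ (fun z : ℝ × ℝ × ℝ × ℝ => Φ z.1 z.2) (Ioo (-δ) δ ×ˢ N) ∧
        (∀ q ∈ N, Φ 0 q = q) ∧
        (∀ ε ∈ Ioo (-δ) δ, ∀ q ∈ N,
          Φ ε q ∈ Ω ∧ HasDerivAt (fun s => Φ s q) (V (Φ ε q)) ε) ∧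
        ∀ ε ∈ Ioo (-δ) δ, MapsSolutions α β a b N (Φ ε)

/-! ### The infinitesimal criterion

First-order jets are written `(p, u_t, u_x)` with `p = (t, x, u)`. -/

/-- Total derivative `D_t f = f_t + u_t f_u` of a function `f` of `(t, x, u)`. -/
def totalDt (f : ℝ × ℝ × ℝ → ℝ) (p : ℝ × ℝ × ℝ) (ut : ℝ) : ℝ :=
  fderiv ℝ f p (1, 0, ut)

/-- Total derivative `D_x f = f_x + u_x f_u` of a function `f` of `(t, x, u)`. -/
def totalDx (f : ℝ × ℝ × ℝ → ℝ) (p : ℝ × ℝ × ℝ) (ux : ℝ) : ℝ :=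
  fderiv ℝ f p (0, 1, ux)

/-- Total derivative `D_x F = F_x + u_x F_u + u_tx F_{u_t} + u_xx F_{u_x}` of a function `F` of
first-order jets. -/
def totalDxJet (F : (ℝ × ℝ × ℝ) × ℝ × ℝ → ℝ) (p : ℝ × ℝ × ℝ) (ut ux utx uxx : ℝ) : ℝ :=
  fderiv ℝ F (p, ut, ux) ((0, 1, ux), utx, uxx)

/-- `η^t = D_t η - u_x D_t ξ - u_t D_t τ`. -/
def etaT (V : ℝ × ℝ × ℝ → ℝ × ℝ × ℝ) (j : (ℝ × ℝ × ℝ) × ℝ × ℝ) : ℝ :=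
  totalDt (fun q => (V q).2.2) j.1 j.2.1
    - j.2.2 * totalDt (fun q => (V q).2.1) j.1 j.2.1
    - j.2.1 * totalDt (fun q => (V q).1) j.1 j.2.1

/-- `η^x = D_x η - u_x D_x ξ - u_t D_x τ`. -/
def etaX (V : ℝ × ℝ × ℝ → ℝ × ℝ × ℝ) (j : (ℝ × ℝ × ℝ) × ℝ × ℝ) : ℝ :=
  totalDx (fun q => (V q).2.2) j.1 j.2.2
    - j.2.2 * totalDx (fun q => (V q).2.1) j.1 j.2.2
    - j.2.1 * totalDx (fun q => (V q).1) j.1 j.2.2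

/-- `η^{xx} = D_x η^x - u_xx D_x ξ - u_tx D_x τ`. -/
def etaXX (V : ℝ × ℝ × ℝ → ℝ × ℝ × ℝ) (p : ℝ × ℝ × ℝ) (ut ux utx uxx : ℝ) : ℝ :=
  totalDxJet (etaX V) p ut ux utx uxx
    - uxx * totalDx (fun q => (V q).2.1) p ux
    - utx * totalDx (fun q => (V q).1) p ux

/-- The left-hand side of the equation as a function of the jet
`((t, x, u), (u_t, u_x, u_xx))`; for `t, x > 0` one has `∂^β u/∂t^β = t^(1-β) u_t`,
`∂^α u/∂x^α = x^(1-α) u_x` and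
`∂^{2α} u/∂x^{2α} = x^(2-2α) u_xx + (1-α) x^(1-2α) u_x`. -/
def jetLHS (α β a b : ℝ) (j : (ℝ × ℝ × ℝ) × ℝ × ℝ × ℝ) : ℝ :=
  j.1.1 ^ (1 - β) * j.2.1
    + a * j.1.2.2 ^ 2 * (j.1.2.1 ^ (1 - α) * j.2.2.1)
    + b * (j.1.2.1 ^ (2 - 2 * α) * j.2.2.2 + (1 - α) * j.1.2.1 ^ (1 - 2 * α) * j.2.2.1)

/-- The Lie symmetry condition for a smooth vector field `V` on `Ω`: the prolongation of `V`
annihilates the left-hand side of the equation at all jets over `Ω` at which that side is zero. -/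
def LieCondition (α β a b : ℝ) (Ω : Set (ℝ × ℝ × ℝ)) (V : ℝ × ℝ × ℝ → ℝ × ℝ × ℝ) : Prop :=
  ContDiffOn ℝ ∞ V Ω ∧
    ∀ p ∈ Ω, ∀ ut ux utx uxx : ℝ, jetLHS α β a b (p, ut, ux, uxx) = 0 →
      fderiv ℝ (jetLHS α β a b) (p, ut, ux, uxx)
        (V p, etaT V (p, ut, ux), etaX V (p, ut, ux), etaXX V p ut ux utx uxx) = 0

/-- `V₁ = t^(1-β) ∂_t`. -/
def V₁ (β : ℝ) (p : ℝ × ℝ × ℝ) : ℝ × ℝ × ℝ := (p.1 ^ (1 - β), 0, 0)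

/-- `V₂ = x^(1-α) ∂_x`. -/
def V₂ (α : ℝ) (p : ℝ × ℝ × ℝ) : ℝ × ℝ × ℝ := (0, p.2.1 ^ (1 - α), 0)

/-- `V₃ = (4t/β) ∂_t + (2x/α) ∂_x - u ∂_u`. -/
def V₃ (α β : ℝ) (p : ℝ × ℝ × ℝ) : ℝ × ℝ × ℝ := (4 * p.1 / β, 2 * p.2.1 / α, -p.2.2)

end ConformableBurgers

end

/-! In the variables s = t^β/β and y = x^α/α the conformable derivatives are ∂_s and ∂_y, and the
equation is u_s + a u² u_y + b u_yy = 0. The proof keeps t and x, but uses the weighted derivatives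
`dS` = t^(1-β) ∂_t, `dY` = x^(1-α) ∂_x and the weighted components T = t^(β-1) τ, X = x^(α-1) ξ of
the field. Subscripts s, y below refer to these derivatives.

Necessity rests on travelling waves. A wave u = f(y - c s) is a solution when f' = G(f) with G'(v) =
(c - a v²)/b, and through each point there is one for every velocity c and slope P (`exists_wave`).
A local group of symmetries deforms it into a smooth family of solutions (`exists_deformation`),
whose ε-derivative at 0 is the characteristic η - τ u_t - ξ u_x and solves the linearized equation
(`linearized_equation`). Along the wave u_s = -c G(u) and u_y = G(u), so the characteristic is a
function of (t, x, u), and its linearized equation says that the prolongation vanishes at the jet of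
the wave (`linearized_waveCharacteristic`). The infinitesimal criterion, restricted to these jets,
gives the same condition `VanishesOnWaves` by `prolongation_eq_weighted`.

That condition is polynomial in c and P, and its coefficients are the determining equations
(`determining_equations`). As a and b are nonzero, they force k = T_s = 2 X_y to have zero gradient,
T_y = T_u = X_s = X_u = 0 and η = -k u/4 (`determining_equations_consequences`). On a connected set
this integrates to three constants, with c₁ = -k/4 (`solve_determining_equations`).

Sufficiency is explicit. The flow acts affinely on t^β and x^α and multiplies u by l = exp(c₁ ε);
the slopes l^(-4) and l^(-2) make every term of the equation acquire the factor l^5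
(`mapsSolutions_scaling`). Infinitesimally, the prolongation multiplies the left-hand side by 5 c₁
(`weightedProlongation_symField`). -/

namespace ConformableBurgers

/-! ### Partial derivatives of smooth functions on open sets -/

section PartialDerivatives

variable {F : Type*} [NormedAddCommGroup F] [NormedSpace ℝ F]

/-- The derivative of `f` in the fixed direction `v`. -/
noncomputable def pd (v : F) (f : F → ℝ) (p : F) : ℝ := fderiv ℝ f p v

variable {S : Set F} {f g : F → ℝ} {p : F}

lemma contDiffAt_of_mem {G : Type*} [NormedAddCommGroup G] [NormedSpace ℝ G] {f : F → G}
    (hS : IsOpen S) (hf : ContDiffOn ℝ ∞ f S) (hp : p ∈ S) : ContDiffAt ℝ ∞ f p :=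
  hf.contDiffAt (hS.mem_nhds hp)

lemma differentiableAt_of_mem {G : Type*} [NormedAddCommGroup G] [NormedSpace ℝ G] {f : F → G}
    (hS : IsOpen S) (hf : ContDiffOn ℝ ∞ f S) (hp : p ∈ S) : DifferentiableAt ℝ f p :=
  (contDiffAt_of_mem hS hf hp).differentiableAt (by simp)

lemma contDiffOn_pd (hS : IsOpen S) (hf : ContDiffOn ℝ ∞ f S) (v : F) :
    ContDiffOn ℝ ∞ (pd v f) S :=
  (hf.fderiv_of_isOpen hS (by simp)).clm_apply contDiffOn_const

lemma fderiv_fderiv_apply (hS : IsOpen S) (hf : ContDiffOn ℝ ∞ f S) (hp : p ∈ S) (v w : F) :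
    fderiv ℝ (fderiv ℝ f) p w v = pd w (pd v f) p := by
  have h := differentiableAt_of_mem hS
    (hf.fderiv_of_isOpen (m := ∞) hS (by simp)) hp
  have h2 := h.hasFDerivAt.clm_apply (hasFDerivAt_const v p)
  have h3 : fderiv ℝ (pd v f) p = _ := h2.fderiv
  simp [pd, h3]

lemma pd_comm (hS : IsOpen S) (hf : ContDiffOn ℝ ∞ f S) (hp : p ∈ S) (v w : F) :
    pd v (pd w f) p = pd w (pd v f) p := by
  rw [← fderiv_fderiv_apply hS hf hp, ← fderiv_fderiv_apply hS hf hp]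
  exact (contDiffAt_of_mem hS hf hp).isSymmSndFDerivAt
    (by
      rw [minSmoothness_of_isRCLikeNormedField]
      exact WithTop.coe_le_coe.2 (le_top : (2 : ℕ∞) ≤ ⊤)) v w

lemma pd_congr (hS : IsOpen S) (h : EqOn f g S) (hp : p ∈ S) (v : F) : pd v f p = pd v g p := by
  have : f =ᶠ[𝓝 p] g := h.eventuallyEq_of_mem (hS.mem_nhds hp)
  rw [pd, pd, this.fderiv_eq]

lemma pd_eq_zero (hS : IsOpen S) (h : ∀ q ∈ S, f q = 0) (hp : p ∈ S) (v : F) : pd v f p = 0 := by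
  rw [pd_congr (g := fun _ => 0) hS h hp]
  simp [pd]

lemma hasDerivAt_line (hS : IsOpen S) (hf : ContDiffOn ℝ ∞ f S) (hp : p ∈ S) (v : F) :
    HasDerivAt (fun s : ℝ => f (p + s • v)) (pd v f p) 0 := by
  have h := (differentiableAt_of_mem hS hf hp).hasFDerivAt
  have h1 : HasDerivAt (fun s : ℝ => p + s • v) v 0 := by
    simpa using ((hasDerivAt_id (0 : ℝ)).smul_const v).const_add p
  have h2 : HasFDerivAt f (fderiv ℝ f p) (p + (0 : ℝ) • v) := by simpa using h
  exact h2.comp_hasDerivAt 0 h1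

/-- An identity on an open set can be differentiated along a line. -/
lemma deriv_line_eq_zero (hS : IsOpen S) (h : ∀ q ∈ S, f q = 0) (hp : p ∈ S) (v : F) {d : ℝ}
    (hd : HasDerivAt (fun s : ℝ => f (p + s • v)) d 0) : d = 0 := by
  have hc : Continuous fun s : ℝ => p + s • v := by fun_prop
  have : (fun s : ℝ => f (p + s • v)) =ᶠ[𝓝 0] fun _ => 0 := by
    have := hc.continuousAt.preimage_mem_nhds (x := 0) (t := S) (hS.mem_nhds (by simpa using hp))
    filter_upwards [this] with s hs using h _ hs
  exact hd.unique ((hasDerivAt_const _ _).congr_of_eventuallyEq this)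

end PartialDerivatives

lemma fderiv_triple (f : ℝ × ℝ × ℝ → ℝ) (p : ℝ × ℝ × ℝ) (x y z : ℝ) :
    fderiv ℝ f p (x, y, z) =
      x * pd (1, 0, 0) f p + y * pd (0, 1, 0) f p + z * pd (0, 0, 1) f p := by
  have : ((x, y, z) : ℝ × ℝ × ℝ) = x • (1, 0, 0) + y • (0, 1, 0) + z • (0, 0, 1) := by simp
  rw [this]
  simp only [map_add, map_smul, smul_eq_mul, pd]

/-! ### The conformable derivative of a differentiable function -/

lemma confDeriv_eq_of_hasDerivAt {α t f' : ℝ} {f : ℝ → ℝ} (h : HasDerivAt f f' t) :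
    confDeriv α f t = t ^ (1 - α) * f' := by
  have h1 : HasDerivAt (fun ε : ℝ => f (t + ε * t ^ (1 - α))) (f' * t ^ (1 - α)) 0 := by
    have h2 : HasDerivAt (fun ε : ℝ => t + ε * t ^ (1 - α)) (t ^ (1 - α)) 0 := by
      simpa using ((hasDerivAt_id (0 : ℝ)).mul_const (t ^ (1 - α))).const_add t
    have h3 : HasDerivAt f f' (t + 0 * t ^ (1 - α)) := by simpa using h
    exact h3.comp 0 h2
  rw [hasDerivAt_iff_tendsto_slope] at h1
  rw [confDeriv, mul_comm]
  refine Tendsto.limUnder_eq (h1.congr fun ε => ?_)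
  simp [slope_def_field]

/-- The point t + ε t^(1-α) tends to t, so the difference quotients agree for small ε. No
differentiability is needed: the limits coincide even as default values. -/
lemma confDeriv_congr {α t : ℝ} {f g : ℝ → ℝ} (h : f =ᶠ[𝓝 t] g) :
    confDeriv α f t = confDeriv α g t := by
  have hc : Tendsto (fun ε : ℝ => t + ε * t ^ (1 - α)) (𝓝[≠] 0) (𝓝 t) := by
    have : Continuous fun ε : ℝ => t + ε * t ^ (1 - α) := by fun_prop
    simpa using (this.tendsto 0).mono_left nhdsWithin_le_nhds
  have : (fun ε : ℝ => (f (t + ε * t ^ (1 - α)) - f t) / ε) =ᶠ[𝓝[≠] 0]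
      fun ε : ℝ => (g (t + ε * t ^ (1 - α)) - g t) / ε := by
    filter_upwards [hc.eventually h] with ε hε
    rw [hε, h.eq_of_nhds]
  rw [confDeriv, confDeriv, limUnder, limUnder, map_congr this]

lemma hasDerivAt_rpow_one_sub {α x : ℝ} (hx : 0 < x) :
    HasDerivAt (fun y : ℝ => y ^ (1 - α)) ((1 - α) * x ^ (1 - α) / x) x := by
  convert Real.hasDerivAt_rpow_const (p := 1 - α) (Or.inl hx.ne') using 1
  rw [Real.rpow_sub_one hx.ne', mul_div_assoc]

/-- All powers of x in the equation are expressed through x^(1-α) and 1/x. Later identities are then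
rational in this one power, which can be treated as an atom. -/
lemma rpow_two_sub {α x : ℝ} (hx : 0 < x) : x ^ (2 - 2 * α) = (x ^ (1 - α)) ^ 2 := by
  rw [← Real.rpow_natCast, ← Real.rpow_mul hx.le]
  congr 1; push_cast; ring

lemma rpow_one_sub_two {α x : ℝ} (hx : 0 < x) : x ^ (1 - 2 * α) = (x ^ (1 - α)) ^ 2 / x := by
  rw [← rpow_two_sub hx, ← Real.rpow_sub_one hx.ne']
  congr 1; ring

lemma jetLHS_eq {α β a b t x u ut ux uxx : ℝ} (hx : 0 < x) :
    jetLHS α β a b ((t, x, u), (ut, ux, uxx)) =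
      t ^ (1 - β) * ut + a * u ^ 2 * (x ^ (1 - α) * ux)
        + b * ((x ^ (1 - α)) ^ 2 * uxx + (1 - α) * ((x ^ (1 - α)) ^ 2 / x) * ux) := by
  simp only [jetLHS, rpow_two_sub hx, rpow_one_sub_two hx]

lemma hasDerivAt_fst {D : Set (ℝ × ℝ)} {u : ℝ × ℝ → ℝ} {t x : ℝ} (hD : IsOpen D)
    (hu : ContDiffOn ℝ ∞ u D) (h : (t, x) ∈ D) :
    HasDerivAt (fun s => u (s, x)) (pd (1, 0) u (t, x)) t :=
  (differentiableAt_of_mem hD hu h).hasFDerivAt.comp_hasDerivAt t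
    ((hasDerivAt_id t).prodMk (hasDerivAt_const t x))

lemma hasDerivAt_snd {D : Set (ℝ × ℝ)} {u : ℝ × ℝ → ℝ} {t x : ℝ} (hD : IsOpen D)
    (hu : ContDiffOn ℝ ∞ u D) (h : (t, x) ∈ D) :
    HasDerivAt (fun y => u (t, y)) (pd (0, 1) u (t, x)) x :=
  (differentiableAt_of_mem hD hu h).hasFDerivAt.comp_hasDerivAt x
    ((hasDerivAt_const x t).prodMk (hasDerivAt_id x))

lemma eventually_mem_snd {D : Set (ℝ × ℝ)} {t x : ℝ} (hD : IsOpen D) (h : (t, x) ∈ D) :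
    ∀ᶠ y in 𝓝 x, (t, y) ∈ D :=
  (Continuous.prodMk_right t).continuousAt.preimage_mem_nhds (hD.mem_nhds h)

lemma eventually_mem_fst {D : Set (ℝ × ℝ)} {t x : ℝ} (hD : IsOpen D) (h : (t, x) ∈ D) :
    ∀ᶠ s in 𝓝 t, (s, x) ∈ D :=
  (Continuous.prodMk_left x).continuousAt.preimage_mem_nhds (hD.mem_nhds h)

/-! ### The weighted derivatives `t^(1-β) ∂_t`, `x^(1-α) ∂_x` and `∂_u` -/

/-- `t^(1-β) ∂_t f`. -/
noncomputable def dS (β : ℝ) (f : ℝ × ℝ × ℝ → ℝ) (p : ℝ × ℝ × ℝ) : ℝ :=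
  p.1 ^ (1 - β) * pd (1, 0, 0) f p

/-- `x^(1-α) ∂_x f`. -/
noncomputable def dY (α : ℝ) (f : ℝ × ℝ × ℝ → ℝ) (p : ℝ × ℝ × ℝ) : ℝ :=
  p.2.1 ^ (1 - α) * pd (0, 1, 0) f p

/-- `∂_u f`. -/
noncomputable def dU (f : ℝ × ℝ × ℝ → ℝ) : ℝ × ℝ × ℝ → ℝ := pd (0, 0, 1) f

section WeightedDerivatives

variable {α β : ℝ} {Ω : Set (ℝ × ℝ × ℝ)} {f : ℝ × ℝ × ℝ → ℝ} {p : ℝ × ℝ × ℝ}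

lemma hasFDerivAt_rpow_fst (r : ℝ) (hp : 0 < p.1) :
    HasFDerivAt (fun q : ℝ × ℝ × ℝ => q.1 ^ r)
      ((r * p.1 ^ r / p.1) • ContinuousLinearMap.fst ℝ ℝ (ℝ × ℝ)) p := by
  have h := (hasFDerivAt_fst (𝕜 := ℝ) (p := p)).rpow_const (p := r) (Or.inl hp.ne')
  rwa [Real.rpow_sub_one hp.ne', ← mul_div_assoc] at h

lemma hasFDerivAt_rpow_snd (r : ℝ) (hp : 0 < p.2.1) :
    HasFDerivAt (fun q : ℝ × ℝ × ℝ => q.2.1 ^ r)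
      ((r * p.2.1 ^ r / p.2.1) •
        (ContinuousLinearMap.fst ℝ ℝ ℝ).comp (ContinuousLinearMap.snd ℝ ℝ (ℝ × ℝ))) p := by
  have h : HasFDerivAt (fun q : ℝ × ℝ × ℝ => q.2.1)
      ((ContinuousLinearMap.fst ℝ ℝ ℝ).comp (ContinuousLinearMap.snd ℝ ℝ (ℝ × ℝ))) p :=
    ((ContinuousLinearMap.fst ℝ ℝ ℝ).comp (ContinuousLinearMap.snd ℝ ℝ (ℝ × ℝ))).hasFDerivAt
  have h' := h.rpow_const (p := r) (Or.inl hp.ne')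
  rwa [Real.rpow_sub_one hp.ne', ← mul_div_assoc] at h'

lemma contDiffOn_rpow_fst (hΩ : ∀ p ∈ Ω, 0 < p.1 ∧ 0 < p.2.1) (r : ℝ) :
    ContDiffOn ℝ ∞ (fun q : ℝ × ℝ × ℝ => q.1 ^ r) Ω :=
  contDiffOn_fst.rpow_const_of_ne fun p hp => (hΩ p hp).1.ne'

lemma contDiffOn_rpow_snd (hΩ : ∀ p ∈ Ω, 0 < p.1 ∧ 0 < p.2.1) (r : ℝ) :
    ContDiffOn ℝ ∞ (fun q : ℝ × ℝ × ℝ => q.2.1 ^ r) Ω :=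
  (contDiff_fst.comp contDiff_snd).contDiffOn.rpow_const_of_ne fun p hp => (hΩ p hp).2.ne'

variable (hΩo : IsOpen Ω) (hΩ : ∀ p ∈ Ω, 0 < p.1 ∧ 0 < p.2.1) (hf : ContDiffOn ℝ ∞ f Ω)
  (hp : p ∈ Ω)
include hΩo hΩ hf

lemma contDiffOn_dS : ContDiffOn ℝ ∞ (dS β f) Ω :=
  (contDiffOn_rpow_fst hΩ _).mul (contDiffOn_pd hΩo hf _)

lemma contDiffOn_dY : ContDiffOn ℝ ∞ (dY α f) Ω :=
  (contDiffOn_rpow_snd hΩ _).mul (contDiffOn_pd hΩo hf _)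

include hp

lemma pd_dS (v : ℝ × ℝ × ℝ) :
    pd v (dS β f) p = p.1 ^ (1 - β) * pd v (pd (1, 0, 0) f) p
      + (1 - β) * p.1 ^ (1 - β) / p.1 * v.1 * pd (1, 0, 0) f p := by
  have h := (hasFDerivAt_rpow_fst (1 - β) (hΩ p hp).1).mul
    (differentiableAt_of_mem hΩo (contDiffOn_pd hΩo hf (1, 0, 0)) hp).hasFDerivAt
  have h2 : fderiv ℝ (dS β f) p = _ := h.fderiv
  rw [pd, h2]
  simp [pd]
  ring

lemma pd_dY (v : ℝ × ℝ × ℝ) :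
    pd v (dY α f) p = p.2.1 ^ (1 - α) * pd v (pd (0, 1, 0) f) p
      + (1 - α) * p.2.1 ^ (1 - α) / p.2.1 * v.2.1 * pd (0, 1, 0) f p := by
  have h := (hasFDerivAt_rpow_snd (1 - α) (hΩ p hp).2).mul
    (differentiableAt_of_mem hΩo (contDiffOn_pd hΩo hf (0, 1, 0)) hp).hasFDerivAt
  have h2 : fderiv ℝ (dY α f) p = _ := h.fderiv
  rw [pd, h2]
  simp [pd]
  ring

lemma dU_dS : dU (dS β f) p = dS β (dU f) p := by
  rw [dU, pd_dS hΩo hΩ hf hp, pd_comm hΩo hf hp]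
  simp [dS, dU]

lemma dU_dY : dU (dY α f) p = dY α (dU f) p := by
  rw [dU, pd_dY hΩo hΩ hf hp, pd_comm hΩo hf hp]
  simp [dY, dU]

/-- Each weight depends only on the variable of its own derivative, so the weighted derivatives
commute as ∂_s and ∂_y do. -/
lemma dY_dS : dY α (dS β f) p = dS β (dY α f) p := by
  rw [dY, pd_dS hΩo hΩ hf hp, dS, pd_dY hΩo hΩ hf hp, pd_comm hΩo hf hp]
  simp only [mul_zero, zero_mul, add_zero]
  ring

end WeightedDerivatives

/-! ### The determining equations -/

/-- The prolongation of `T t^(1-β) ∂_t + X x^(1-α) ∂_x + η ∂_u` applied to the left-hand side of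
the equation, at the jet with `q = t^(1-β) u_t`, `P = x^(1-α) u_x`, `r` the sequential second
derivative and `m = t^(1-β) x^(1-α) u_tx`. -/
noncomputable def weightedProlongation (α β a b : ℝ) (T X η : ℝ × ℝ × ℝ → ℝ) (p : ℝ × ℝ × ℝ)
    (q P m r : ℝ) : ℝ :=
  (dS β η p + q * dU η p - P * (dS β X p + q * dU X p) - q * (dS β T p + q * dU T p))
    + 2 * a * p.2.2 * η p * P
    + a * p.2.2 ^ 2 * (dY α η p + P * dU η p - P * (dY α X p + P * dU X p)
        - q * (dY α T p + P * dU T p))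
    + b * (dY α (dY α η) p + 2 * P * dU (dY α η) p + P ^ 2 * dU (dU η) p + r * dU η p
        - P * (dY α (dY α X) p + 2 * P * dU (dY α X) p + P ^ 2 * dU (dU X) p + r * dU X p)
        - 2 * r * (dY α X p + P * dU X p)
        - q * (dY α (dY α T) p + 2 * P * dU (dY α T) p + P ^ 2 * dU (dU T) p + r * dU T p)
        - 2 * m * (dY α T p + P * dU T p))

/-- The prolongation vanishes at the jets of travelling waves: `q = -c P` and
`b r = (c - a u²) P`. -/
def VanishesOnWaves (α β a b : ℝ) (Ω : Set (ℝ × ℝ × ℝ)) (T X η : ℝ × ℝ × ℝ → ℝ) : Prop :=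
  ∀ p ∈ Ω, ∀ c P : ℝ, weightedProlongation α β a b T X η p (-c * P) P
    (-c * (P * (c - a * p.2.2 ^ 2) / b)) (P * (c - a * p.2.2 ^ 2) / b) = 0

/-- Four values determine a cubic. The top coefficient is left out because the determining equations
do not need it. -/
lemma cubic_coeff_eq_zero {k₀ k₁ k₂ k₃ : ℝ} (h : ∀ x : ℝ, k₀ + k₁ * x + k₂ * x ^ 2 + k₃ * x ^ 3 = 0) :
    k₀ = 0 ∧ k₁ = 0 ∧ k₂ = 0 := by
  have h0 := h 0
  have h1 := h 1
  have h2 := h (-1)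
  have h3 := h 2
  refine ⟨?_, ?_, ?_⟩ <;> linarith

lemma quadratic_coeff_eq_zero {k₀ k₁ k₂ : ℝ} (h : ∀ x : ℝ, k₀ + k₁ * x + k₂ * x ^ 2 = 0) :
    k₀ = 0 ∧ k₁ = 0 ∧ k₂ = 0 :=
  cubic_coeff_eq_zero (k₃ := 0) fun x => by rw [zero_mul, add_zero, h]

/-- The determining equations at a point, as the coefficients of the powers of `c` and `P`. -/
lemma determining_equations {α β a b : ℝ} (hb : b ≠ 0) {T X η : ℝ × ℝ × ℝ → ℝ} {p : ℝ × ℝ × ℝ}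
    (h : ∀ c P : ℝ, weightedProlongation α β a b T X η p (-c * P) P
      (-c * (P * (c - a * p.2.2 ^ 2) / b)) (P * (c - a * p.2.2 ^ 2) / b) = 0) :
    dU T p = 0 ∧ dY α T p = 0 ∧
    (2 * b * dU (dY α T) p - 2 * dU X p - 2 * a * p.2.2 ^ 2 * dU T p = 0) ∧
    (-2 * b * dU (dY α X) p + b * dU (dU η) p + 2 * a * p.2.2 ^ 2 * dU X p = 0) ∧
    (dS β T p - a * p.2.2 ^ 2 * dY α T p + b * dY α (dY α T) p - 2 * dY α X p = 0) ∧
    (-dS β X p + 2 * a * p.2.2 * η p + a * p.2.2 ^ 2 * dY α X p - b * dY α (dY α X) p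
      + 2 * b * dU (dY α η) p = 0) ∧
    (dS β η p + a * p.2.2 ^ 2 * dY α η p + b * dY α (dY α η) p = 0) := by
  -- For fixed c the condition is a cubic in P without further constraint; its coefficients of P and
  -- P² are in turn quadratics in c.
  have key : ∀ c : ℝ, _ := fun c => cubic_coeff_eq_zero
    (k₀ := dS β η p + a * p.2.2 ^ 2 * dY α η p + b * dY α (dY α η) p)
    (k₁ := (-dS β X p + 2 * a * p.2.2 * η p + a * p.2.2 ^ 2 * dY α X p - b * dY α (dY α X) p
      + 2 * b * dU (dY α η) p) + (dS β T p - a * p.2.2 ^ 2 * dY α T p + b * dY α (dY α T) p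
        - 2 * dY α X p) * c + (2 * dY α T p) * c ^ 2)
    (k₂ := (-2 * b * dU (dY α X) p + b * dU (dU η) p + 2 * a * p.2.2 ^ 2 * dU X p)
      + (2 * b * dU (dY α T) p - 2 * dU X p - 2 * a * p.2.2 ^ 2 * dU T p) * c
      + (2 * dU T p) * c ^ 2)
    (k₃ := -b * (dU (dU X) p - c * dU (dU T) p)) (fun P => by
      rw [← h c P, weightedProlongation]
      field_simp
      ring)
  have h1 := quadratic_coeff_eq_zero fun c => (key c).2.1
  have h2 := quadratic_coeff_eq_zero fun c => (key c).2.2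
  exact ⟨by linarith [h2.2.2], by linarith [h1.2.2], h2.2.1, h2.1, h1.2.1, h1.1, (key 0).1⟩

/-- Connectedness of Ω is used here. Slices of Ω along a coordinate may be disconnected, so
integration is always done by showing that a full gradient vanishes. -/
lemma exists_const_of_pd_eq_zero {Ω : Set (ℝ × ℝ × ℝ)} {f : ℝ × ℝ × ℝ → ℝ} (hΩo : IsOpen Ω)
    (hΩc : IsConnected Ω) (hf : ContDiffOn ℝ ∞ f Ω)
    (h : ∀ p ∈ Ω, pd (1, 0, 0) f p = 0 ∧ pd (0, 1, 0) f p = 0 ∧ pd (0, 0, 1) f p = 0) :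
    ∃ k, ∀ p ∈ Ω, f p = k := by
  refine hΩo.exists_is_const_of_fderiv_eq_zero (𝕜 := ℝ) hΩc.isPreconnected
    (hf.differentiableOn (by simp)) fun p hp => ?_
  refine ContinuousLinearMap.ext fun ⟨x, y, z⟩ => ?_
  obtain ⟨h1, h2, h3⟩ := h p hp
  rw [fderiv_triple, h1, h2, h3]
  simp

lemma hasDerivAt_line_u (p : ℝ × ℝ × ℝ) :
    HasDerivAt (fun s : ℝ => (p + s • ((0, 0, 1) : ℝ × ℝ × ℝ)).2.2) 1 0 := by
  simpa using (hasDerivAt_id (0 : ℝ)).const_add p.2.2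

/-- This is ∂_s s = 1 for s = t^β/β. -/
lemma rpow_div_mul_rpow_one_sub {t β : ℝ} (ht : 0 < t) : t ^ β / t * t ^ (1 - β) = 1 := by
  rw [← Real.rpow_sub_one ht.ne', ← Real.rpow_add ht]
  simp

section Solve

variable {α β a b : ℝ} {Ω : Set (ℝ × ℝ × ℝ)} {T X η : ℝ × ℝ × ℝ → ℝ}

/-- The consequences of the determining equations, before integration: the common value `k` of
`t^(1-β) ∂_t T = 2 x^(1-α) ∂_x X` has no derivative, and `T`, `X` depend on `t` and `x` only. -/
lemma determining_equations_consequences (ha : a ≠ 0) (hb : b ≠ 0) (hΩo : IsOpen Ω)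
    (hΩ : ∀ p ∈ Ω, 0 < p.1 ∧ 0 < p.2.1) (hT : ContDiffOn ℝ ∞ T Ω) (hX : ContDiffOn ℝ ∞ X Ω)
    (hη : ContDiffOn ℝ ∞ η Ω) (h : VanishesOnWaves α β a b Ω T X η) :
    (∀ p ∈ Ω, dU T p = 0 ∧ dY α T p = 0) ∧ (∀ p ∈ Ω, dU X p = 0 ∧ dS β X p = 0) ∧
    (∀ p ∈ Ω, dS β T p = 2 * dY α X p) ∧ (∀ p ∈ Ω, η p = -(p.2.2 * dS β T p / 4)) ∧
    ∀ p ∈ Ω, pd (1, 0, 0) (dS β T) p = 0 ∧ pd (0, 1, 0) (dS β T) p = 0 ∧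
      pd (0, 0, 1) (dS β T) p = 0 := by
  have D := fun p hp => determining_equations hb (h p hp)
  have B : ∀ p ∈ Ω, p.2.1 ^ (1 - α) ≠ 0 := fun p hp => (Real.rpow_pos_of_pos (hΩ p hp).2 _).ne'
  have A : ∀ p ∈ Ω, p.1 ^ (1 - β) ≠ 0 := fun p hp => (Real.rpow_pos_of_pos (hΩ p hp).1 _).ne'
  have hTu : ∀ p ∈ Ω, dU T p = 0 := fun p hp => (D p hp).1
  have hTy : ∀ p ∈ Ω, dY α T p = 0 := fun p hp => (D p hp).2.1
  have hXu : ∀ p ∈ Ω, dU X p = 0 := fun p hp => by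
    have h1 := (D p hp).2.2.1
    have h2 : dU (dY α T) p = 0 := pd_eq_zero hΩo hTy hp _
    rw [h2, hTu p hp] at h1
    linarith
  have hXyu : ∀ p ∈ Ω, dU (dY α X) p = 0 := fun p hp => by
    rw [dU_dY hΩo hΩ hX hp, dY, pd_eq_zero hΩo hXu hp, mul_zero]
  have hηuu : ∀ p ∈ Ω, dU (dU η) p = 0 := fun p hp => by
    have h1 := (D p hp).2.2.2.1
    rw [hXyu p hp, hXu p hp] at h1
    simpa [hb] using h1
  have hk : ∀ p ∈ Ω, dS β T p = 2 * dY α X p := fun p hp => by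
    have h1 := (D p hp).2.2.2.2.1
    rw [show dY α (dY α T) p = 0 by rw [dY, pd_eq_zero hΩo hTy hp, mul_zero], hTy p hp] at h1
    linarith
  have ku : ∀ p ∈ Ω, pd (0, 0, 1) (dS β T) p = 0 := fun p hp => by
    rw [show pd (0, 0, 1) (dS β T) p = dU (dS β T) p from rfl, dU_dS hΩo hΩ hT hp, dS,
      pd_eq_zero hΩo hTu hp, mul_zero]
  have kx : ∀ p ∈ Ω, pd (0, 1, 0) (dS β T) p = 0 := fun p hp => by
    have h1 : dY α (dS β T) p = 0 := by
      rw [dY_dS hΩo hΩ hT hp, dS, pd_eq_zero hΩo hTy hp, mul_zero]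
    exact (mul_eq_zero.1 h1).resolve_left (B p hp)
  have sT := contDiffOn_dS (β := β) hΩo hΩ hT
  have sX := contDiffOn_dY (α := α) hΩo hΩ hX
  -- The y-derivative of T_s = 2 X_y, whose left side does not depend on y.
  have hXyy : ∀ p ∈ Ω, dY α (dY α X) p = 0 := fun p hp => by
    have h1 := deriv_line_eq_zero hΩo (f := fun q => dS β T q - 2 * dY α X q)
      (fun q hq => by rw [hk q hq, sub_self]) hp (0, 1, 0)
      ((hasDerivAt_line hΩo sT hp _).sub ((hasDerivAt_line hΩo sX hp _).const_mul 2))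
    rw [kx p hp] at h1
    rw [dY, show pd (0, 1, 0) (dY α X) p = 0 by linarith, mul_zero]
  -- The coefficient of P (degree 0 in c) is the only equation linking η to X. Two differentiations
  -- in u will determine η without dividing by u, which may vanish on Ω.
  have R : ∀ p ∈ Ω, -dS β X p + 2 * a * (p.2.2 * η p) + a * (p.2.2 ^ 2 * dY α X p)
      + 2 * b * dU (dY α η) p = 0 := fun p hp => by
    have h1 := (D p hp).2.2.2.2.2.1
    rw [hXyy p hp] at h1
    linarith
  have hηyuu : ∀ p ∈ Ω, dU (dU (dY α η)) p = 0 := fun p hp => by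
    rw [dU, pd_congr hΩo (fun q hq => dU_dY hΩo hΩ hη hq) hp]
    change dU (dY α (dU η)) p = 0
    rw [dU_dY hΩo hΩ (f := dU η) (contDiffOn_pd hΩo hη _) hp, dY, pd_eq_zero hΩo hηuu hp, mul_zero]
  have hXsu : ∀ p ∈ Ω, dU (dS β X) p = 0 := fun p hp => by
    rw [dU_dS hΩo hΩ hX hp, dS, pd_eq_zero hΩo hXu hp, mul_zero]
  -- The u-derivative of `R`, divided by 2a: the terms X_su, X_yu and η_yuu vanish.
  have R1 : ∀ p ∈ Ω, η p + p.2.2 * dU η p + p.2.2 * dS β T p / 2 = 0 := fun p hp => by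
    have h1 := deriv_line_eq_zero hΩo R hp (0, 0, 1)
      ((((hasDerivAt_line hΩo (contDiffOn_dS (β := β) hΩo hΩ hX) hp _).neg.add
        (((hasDerivAt_line_u p).mul (hasDerivAt_line hΩo hη hp _)).const_mul (2 * a))).add
        ((((hasDerivAt_line_u p).pow 2).mul (hasDerivAt_line hΩo sX hp _)).const_mul a)).add
        ((hasDerivAt_line hΩo (contDiffOn_pd hΩo (contDiffOn_dY (α := α) hΩo hΩ hη) _)
          hp _).const_mul (2 * b)))
    have e1 : pd (0, 0, 1) (dS β X) p = 0 := hXsu p hp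
    have e2 : pd (0, 0, 1) (dY α X) p = 0 := hXyu p hp
    have e3 : pd (0, 0, 1) (pd (0, 0, 1) (dY α η)) p = 0 := hηyuu p hp
    simp [e1, e2, e3] at h1
    apply mul_left_cancel₀ (mul_ne_zero two_ne_zero ha)
    rw [hk p hp, dU]
    linear_combination h1
  -- A second u-derivative gives 2 η_u + k/2 = 0, where k = T_s; putting this back into `R1` gives η
  -- = -k u/4.
  have hηu : ∀ p ∈ Ω, dU η p = -(dS β T p / 4) := fun p hp => by
    have h1 := deriv_line_eq_zero hΩo R1 hp (0, 0, 1)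
      (((hasDerivAt_line hΩo hη hp _).add
        ((hasDerivAt_line_u p).mul (hasDerivAt_line hΩo (contDiffOn_pd hΩo hη _) hp _))).add
        (((hasDerivAt_line_u p).mul (hasDerivAt_line hΩo sT hp _)).div_const 2))
    have e1 : pd (0, 0, 1) (pd (0, 0, 1) η) p = 0 := hηuu p hp
    simp [e1, ku p hp] at h1
    rw [dU]
    linear_combination h1 / 2
  have hη' : ∀ p ∈ Ω, η p + p.2.2 * dS β T p / 4 = 0 := fun p hp => by
    have h1 := R1 p hp
    rw [hηu p hp] at h1
    linear_combination h1
  have hηv : ∀ p ∈ Ω, ∀ v : ℝ × ℝ, pd (v.1, v.2, 0) η p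
      + p.2.2 * pd (v.1, v.2, 0) (dS β T) p / 4 = 0 := fun p hp v => by
    have h2 : HasDerivAt (fun s : ℝ => (p + s • ((v.1, v.2, 0) : ℝ × ℝ × ℝ)).2.2) 0 0 := by
      simpa using hasDerivAt_const (0 : ℝ) p.2.2
    have h1 := deriv_line_eq_zero hΩo hη' hp (v.1, v.2, 0)
      ((hasDerivAt_line hΩo hη hp _).add ((h2.mul (hasDerivAt_line hΩo sT hp _)).div_const 4))
    simpa using h1
  have hηy : ∀ p ∈ Ω, dY α η p = 0 := fun p hp => by
    have h1 := hηv p hp (0, 1)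
    simp only [kx p hp, mul_zero, zero_div, add_zero] at h1
    rw [dY, h1, mul_zero]
  have hηs : ∀ p ∈ Ω, dS β η p = 0 := fun p hp => by
    have h1 := (D p hp).2.2.2.2.2.2
    rw [show dY α (dY α η) p = 0 by rw [dY, pd_eq_zero hΩo hηy hp, mul_zero], hηy p hp] at h1
    linarith
  have kt' : ∀ p ∈ Ω, p.2.2 * pd (1, 0, 0) (dS β T) p = 0 := fun p hp => by
    have h1 := hηv p hp (1, 0)
    have h2 : pd (1, 0, 0) η p = 0 := (mul_eq_zero.1 (hηs p hp)).resolve_left (A p hp)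
    simp only [h2] at h1
    linarith
  -- The factor u in u k_t = 0 is removed by differentiating in u, since k_tu = 0. This also covers
  -- the points with u = 0.
  have kt : ∀ p ∈ Ω, pd (1, 0, 0) (dS β T) p = 0 := fun p hp => by
    have h1 := deriv_line_eq_zero hΩo kt' hp (0, 0, 1)
      ((hasDerivAt_line_u p).mul (hasDerivAt_line hΩo (contDiffOn_pd hΩo sT _) hp _))
    rw [pd_comm hΩo sT hp, pd_eq_zero hΩo ku hp] at h1
    simpa using h1
  refine ⟨fun p hp => ⟨hTu p hp, hTy p hp⟩, fun p hp => ⟨hXu p hp, ?_⟩, hk,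
    fun p hp => by linarith [hη' p hp], fun p hp => ⟨kt p hp, kx p hp, ku p hp⟩⟩
  have h1 := R p hp
  rw [show dU (dY α η) p = 0 from pd_eq_zero hΩo hηy hp _] at h1
  linear_combination -h1 + 2 * a * p.2.2 * hη' p hp - a * p.2.2 ^ 2 / 2 * hk p hp

/-- The general solution of the determining equations on a connected open set. -/
lemma solve_determining_equations (hα : 0 < α) (hβ : 0 < β) (ha : a ≠ 0) (hb : b ≠ 0)
    (hΩo : IsOpen Ω) (hΩc : IsConnected Ω)
    (hΩ : ∀ p ∈ Ω, 0 < p.1 ∧ 0 < p.2.1) (hT : ContDiffOn ℝ ∞ T Ω) (hX : ContDiffOn ℝ ∞ X Ω)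
    (hη : ContDiffOn ℝ ∞ η Ω) (h : VanishesOnWaves α β a b Ω T X η) :
    ∃ c₁ c₂ c₃ : ℝ, ∀ p ∈ Ω, T p = -4 * c₁ * (p.1 ^ β / β) + c₂ ∧
      X p = -2 * c₁ * (p.2.1 ^ α / α) + c₃ ∧ η p = c₁ * p.2.2 := by
  obtain ⟨h1, h2, h3, h4, h5⟩ := determining_equations_consequences ha hb hΩo hΩ hT hX hη h
  have B : ∀ p ∈ Ω, p.2.1 ^ (1 - α) ≠ 0 := fun p hp => (Real.rpow_pos_of_pos (hΩ p hp).2 _).ne'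
  have A : ∀ p ∈ Ω, p.1 ^ (1 - β) ≠ 0 := fun p hp => (Real.rpow_pos_of_pos (hΩ p hp).1 _).ne'
  obtain ⟨k, hk⟩ := exists_const_of_pd_eq_zero hΩo hΩc (contDiffOn_dS hΩo hΩ hT) h5
  have hT' : ∀ p ∈ Ω, ∀ v, pd v (fun q => T q - k / β * q.1 ^ β) p
      = pd v T p - k * (p.1 ^ β / p.1 * v.1) := fun p hp v => by
    have := (differentiableAt_of_mem hΩo hT hp).hasFDerivAt.sub
      ((hasFDerivAt_rpow_fst β (hΩ p hp).1).const_mul (k / β))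
    have h' : fderiv ℝ (fun q => T q - k / β * q.1 ^ β) p = _ := this.fderiv
    rw [pd, h', pd]
    simp
    field_simp
  have hX' : ∀ p ∈ Ω, ∀ v, pd v (fun q => X q - k / 2 / α * q.2.1 ^ α) p
      = pd v X p - k / 2 * (p.2.1 ^ α / p.2.1 * v.2.1) := fun p hp v => by
    have := (differentiableAt_of_mem hΩo hX hp).hasFDerivAt.sub
      ((hasFDerivAt_rpow_snd α (hΩ p hp).2).const_mul (k / 2 / α))
    have h' : fderiv ℝ (fun q => X q - k / 2 / α * q.2.1 ^ α) p = _ := this.fderiv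
    rw [pd, h', pd]
    simp
    field_simp
  -- Since T_s = k while T_y = T_u = 0, subtracting k t^β/β leaves a function with zero gradient.
  -- The same is done for X with slope k/2.
  obtain ⟨c₂, hc₂⟩ := exists_const_of_pd_eq_zero (f := fun q => T q - k / β * q.1 ^ β) hΩo hΩc
    (hT.sub (contDiffOn_const.mul (contDiffOn_rpow_fst hΩ β))) fun p hp => by
      have e1 : dU T p = 0 := (h1 p hp).1
      have e2 := (mul_eq_zero.1 (h1 p hp).2).resolve_left (B p hp)
      have e3 := hk p hp
      rw [dU] at e1
      rw [dS] at e3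
      rw [hT' p hp, hT' p hp, hT' p hp, e1, e2]
      refine ⟨mul_left_cancel₀ (A p hp) ?_, by simp, by simp⟩
      linear_combination e3 - k * rpow_div_mul_rpow_one_sub (β := β) (hΩ p hp).1
  obtain ⟨c₃, hc₃⟩ := exists_const_of_pd_eq_zero (f := fun q => X q - k / 2 / α * q.2.1 ^ α) hΩo
    hΩc (hX.sub (contDiffOn_const.mul (contDiffOn_rpow_snd hΩ α))) fun p hp => by
      have e1 : dU X p = 0 := (h2 p hp).1
      have e2 := (mul_eq_zero.1 (h2 p hp).2).resolve_left (A p hp)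
      have e3 := h3 p hp
      rw [dU] at e1
      rw [hk p hp, dY] at e3
      rw [hX' p hp, hX' p hp, hX' p hp, e1, e2]
      refine ⟨by simp, mul_left_cancel₀ (B p hp) ?_, by simp⟩
      linear_combination -e3 / 2 - k / 2 * rpow_div_mul_rpow_one_sub (β := α) (hΩ p hp).2
  refine ⟨-k / 4, c₂, c₃, fun p hp => ⟨?_, ?_, ?_⟩⟩
  · linear_combination hc₂ p hp
  · linear_combination hc₃ p hp
  · rw [h4 p hp, hk p hp]; ring

end Solve

/-! ### The prolongation in weighted form -/

/-- Once differentiability is known, a derivative on jet space in a given direction becomes a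
one-variable computation along a line. -/
lemma fderiv_eq_of_line {F : Type*} [NormedAddCommGroup F] [NormedSpace ℝ F] {f : F → ℝ} {p v : F}
    {d : ℝ} (hf : DifferentiableAt ℝ f p) (h : HasDerivAt (fun s : ℝ => f (p + s • v)) d 0) :
    fderiv ℝ f p v = d := by
  have h1 : HasDerivAt (fun s : ℝ => p + s • v) v 0 := by
    simpa using ((hasDerivAt_id (0 : ℝ)).smul_const v).const_add p
  have h2 : HasFDerivAt f (fderiv ℝ f p) (p + (0 : ℝ) • v) := by simpa using hf.hasFDerivAt
  exact (h2.comp_hasDerivAt 0 h1).unique h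

lemma differentiableAt_jetLHS (α β a b : ℝ) {j : (ℝ × ℝ × ℝ) × ℝ × ℝ × ℝ} (ht : 0 < j.1.1)
    (hx : 0 < j.1.2.1) : DifferentiableAt ℝ (jetLHS α β a b) j := by
  have h1 : ∀ r : ℝ, DifferentiableAt ℝ (fun j : (ℝ × ℝ × ℝ) × ℝ × ℝ × ℝ => j.1.1 ^ r) j :=
    fun r => DifferentiableAt.rpow_const (by fun_prop) (Or.inl ht.ne')
  have h2 : ∀ r : ℝ, DifferentiableAt ℝ (fun j : (ℝ × ℝ × ℝ) × ℝ × ℝ × ℝ => j.1.2.1 ^ r) j :=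
    fun r => DifferentiableAt.rpow_const (by fun_prop) (Or.inl hx.ne')
  unfold jetLHS
  fun_prop

lemma hasDerivAt_affine (x d : ℝ) : HasDerivAt (fun s : ℝ => x + s * d) d 0 := by
  simpa using ((hasDerivAt_id (0 : ℝ)).mul_const d).const_add x

lemma hasDerivAt_affine_rpow {x : ℝ} (hx : 0 < x) (d r : ℝ) :
    HasDerivAt (fun s : ℝ => (x + s * d) ^ r) (r * x ^ r / x * d) 0 := by
  have h := (hasDerivAt_affine x d).rpow_const (p := r) (Or.inl (by simpa using hx.ne'))
  simp only [zero_mul, add_zero] at h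
  rw [Real.rpow_sub_one hx.ne'] at h
  convert h using 1
  ring

/-- The derivative of the left-hand side of the equation. -/
lemma fderiv_jetLHS (α β a b : ℝ) {t x : ℝ} (ht : 0 < t) (hx : 0 < x)
    (u ut ux uxx τ ξ η e₁ e₂ e₃ : ℝ) :
    fderiv ℝ (jetLHS α β a b) ((t, x, u), (ut, ux, uxx)) ((τ, ξ, η), (e₁, e₂, e₃)) =
      t ^ (1 - β) * (e₁ + (1 - β) / t * τ * ut)
        + 2 * a * u * η * (x ^ (1 - α) * ux)
        + a * u ^ 2 * (x ^ (1 - α) * (e₂ + (1 - α) / x * ξ * ux))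
        + b * ((x ^ (1 - α)) ^ 2 * (e₃ + 2 * (1 - α) / x * ξ * uxx
          + (1 - α) / x * (e₂ + (1 - 2 * α) / x * ξ * ux))) := by
  refine fderiv_eq_of_line (differentiableAt_jetLHS α β a b ht hx) ?_
  have h := (((hasDerivAt_affine_rpow ht τ (1 - β)).fun_mul (hasDerivAt_affine ut e₁)).fun_add
    ((((hasDerivAt_affine u η).fun_pow 2).const_mul a).fun_mul
      ((hasDerivAt_affine_rpow hx ξ (1 - α)).fun_mul (hasDerivAt_affine ux e₂)))).fun_add
    ((((hasDerivAt_affine_rpow hx ξ (2 - 2 * α)).fun_mul (hasDerivAt_affine uxx e₃)).fun_add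
      (((hasDerivAt_affine_rpow hx ξ (1 - 2 * α)).const_mul (1 - α)).fun_mul
        (hasDerivAt_affine ux e₂))).const_mul b)
  refine h.congr_deriv ?_
  simp only [zero_mul, add_zero, rpow_two_sub hx, rpow_one_sub_two hx]
  field_simp
  ring

lemma pd_tangent (f : ℝ × ℝ × ℝ → ℝ) (p : ℝ × ℝ × ℝ) (z : ℝ) :
    pd (0, 1, z) f p = pd (0, 1, 0) f p + z * pd (0, 0, 1) f p := by
  rw [pd, fderiv_triple]
  ring

section Prolongation

variable {α β a b : ℝ} {Ω : Set (ℝ × ℝ × ℝ)} {f : ℝ × ℝ × ℝ → ℝ} {p : ℝ × ℝ × ℝ}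

/-- The function `etaX V` is polynomial in u_t and u_x, with coefficients that are first derivatives
of the components of V. It is differentiated along the line in direction (w, u_tx, u_xx). -/
lemma fderiv_etaX {V : ℝ × ℝ × ℝ → ℝ × ℝ × ℝ} (hΩo : IsOpen Ω)
    (hV : ContDiffOn ℝ ∞ V Ω) (hp : p ∈ Ω) (ut ux : ℝ) (w : ℝ × ℝ × ℝ) (utx uxx : ℝ) :
    fderiv ℝ (etaX V) (p, ut, ux) (w, utx, uxx) =
      (pd w (pd (0, 1, 0) fun q => (V q).2.2) p
        + (uxx * pd (0, 0, 1) (fun q => (V q).2.2) p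
          + ux * pd w (pd (0, 0, 1) fun q => (V q).2.2) p))
      - (uxx * (pd (0, 1, 0) (fun q => (V q).2.1) p + ux * pd (0, 0, 1) (fun q => (V q).2.1) p)
        + ux * (pd w (pd (0, 1, 0) fun q => (V q).2.1) p
          + (uxx * pd (0, 0, 1) (fun q => (V q).2.1) p
            + ux * pd w (pd (0, 0, 1) fun q => (V q).2.1) p)))
      - (utx * (pd (0, 1, 0) (fun q => (V q).1) p + ux * pd (0, 0, 1) (fun q => (V q).1) p)
        + ut * (pd w (pd (0, 1, 0) fun q => (V q).1) p
          + (uxx * pd (0, 0, 1) (fun q => (V q).1) p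
            + ux * pd w (pd (0, 0, 1) fun q => (V q).1) p))) := by
  have h1 : ContDiffOn ℝ ∞ (fun q => (V q).1) Ω := hV.fst
  have h2 : ContDiffOn ℝ ∞ (fun q => (V q).2.1) Ω := hV.snd.fst
  have h3 : ContDiffOn ℝ ∞ (fun q => (V q).2.2) Ω := hV.snd.snd
  have e : etaX V = fun j => pd (0, 1, 0) (fun q => (V q).2.2) j.1
        + j.2.2 * pd (0, 0, 1) (fun q => (V q).2.2) j.1
      - j.2.2 * (pd (0, 1, 0) (fun q => (V q).2.1) j.1
        + j.2.2 * pd (0, 0, 1) (fun q => (V q).2.1) j.1)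
      - j.2.1 * (pd (0, 1, 0) (fun q => (V q).1) j.1
        + j.2.2 * pd (0, 0, 1) (fun q => (V q).1) j.1) := by
    funext j
    simp only [etaX, totalDx, fderiv_triple]
    ring
  have hd : ∀ {g : ℝ × ℝ × ℝ → ℝ}, ContDiffOn ℝ ∞ g Ω → ∀ v : ℝ × ℝ × ℝ,
      DifferentiableAt ℝ (fun j : (ℝ × ℝ × ℝ) × ℝ × ℝ => pd v g j.1) (p, ut, ux) :=
    fun hg v => (differentiableAt_of_mem hΩo (contDiffOn_pd hΩo hg v) hp).comp
      (f := fun j : (ℝ × ℝ × ℝ) × ℝ × ℝ => j.1) (p, ut, ux) differentiableAt_fst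
  have hl : ∀ {g : ℝ × ℝ × ℝ → ℝ}, ContDiffOn ℝ ∞ g Ω → ∀ v : ℝ × ℝ × ℝ,
      HasDerivAt (fun s : ℝ => pd v g (p + s • w)) (pd w (pd v g) p) 0 :=
    fun hg v => hasDerivAt_line hΩo (contDiffOn_pd hΩo hg v) hp w
  rw [e]
  refine fderiv_eq_of_line ?_ ?_
  · have := hd h1 (0, 1, 0)
    have := hd h1 (0, 0, 1)
    have := hd h2 (0, 1, 0)
    have := hd h2 (0, 0, 1)
    have := hd h3 (0, 1, 0)
    have := hd h3 (0, 0, 1)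
    fun_prop
  · have h := (((hl h3 (0, 1, 0)).fun_add
      ((hasDerivAt_affine ux uxx).fun_mul (hl h3 (0, 0, 1)))).fun_sub
      ((hasDerivAt_affine ux uxx).fun_mul ((hl h2 (0, 1, 0)).fun_add
        ((hasDerivAt_affine ux uxx).fun_mul (hl h2 (0, 0, 1)))))).fun_sub
      ((hasDerivAt_affine ut utx).fun_mul ((hl h1 (0, 1, 0)).fun_add
        ((hasDerivAt_affine ux uxx).fun_mul (hl h1 (0, 0, 1)))))
    refine h.congr_deriv ?_
    simp only [zero_mul, add_zero, zero_smul]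

variable (hΩo : IsOpen Ω) (hΩ : ∀ p ∈ Ω, 0 < p.1 ∧ 0 < p.2.1) (hf : ContDiffOn ℝ ∞ f Ω)
  (hp : p ∈ Ω)

lemma rpow_sub_one_eq_inv {t : ℝ} (ht : 0 < t) (β : ℝ) : t ^ (β - 1) = (t ^ (1 - β))⁻¹ := by
  rw [← Real.rpow_neg ht.le, neg_sub]

include hΩ hf in
lemma contDiffOn_weight_fst : ContDiffOn ℝ ∞ (fun q => q.1 ^ (β - 1) * f q) Ω :=
  (contDiffOn_rpow_fst hΩ _).mul hf

include hΩ hf in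
lemma contDiffOn_weight_snd : ContDiffOn ℝ ∞ (fun q => q.2.1 ^ (α - 1) * f q) Ω :=
  (contDiffOn_rpow_snd hΩ _).mul hf

include hΩo hΩ hf hp

lemma pd_weight_fst (v : ℝ × ℝ × ℝ) :
    pd v (fun q => q.1 ^ (β - 1) * f q) p
      = p.1 ^ (β - 1) * (pd v f p - (1 - β) / p.1 * v.1 * f p) := by
  have h := (hasFDerivAt_rpow_fst (β - 1) (hΩ p hp).1).mul
    (differentiableAt_of_mem hΩo hf hp).hasFDerivAt
  have h2 : fderiv ℝ (fun q => q.1 ^ (β - 1) * f q) p = _ := h.fderiv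
  rw [pd, h2]
  simp [pd]
  ring

lemma pd_weight_snd (v : ℝ × ℝ × ℝ) :
    pd v (fun q => q.2.1 ^ (α - 1) * f q) p
      = p.2.1 ^ (α - 1) * (pd v f p - (1 - α) / p.2.1 * v.2.1 * f p) := by
  have h := (hasFDerivAt_rpow_snd (α - 1) (hΩ p hp).2).mul
    (differentiableAt_of_mem hΩo hf hp).hasFDerivAt
  have h2 : fderiv ℝ (fun q => q.2.1 ^ (α - 1) * f q) p = _ := h.fderiv
  rw [pd, h2]
  simp [pd]
  ring

/-- A direction that does not move t sees the weight t^(β-1) as a constant. -/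
lemma pd_pd_weight_fst {v w : ℝ × ℝ × ℝ} (hv : v.1 = 0) (hw : w.1 = 0) :
    pd w (pd v (fun q => q.1 ^ (β - 1) * f q)) p = p.1 ^ (β - 1) * pd w (pd v f) p := by
  have h : EqOn (pd v (fun q => q.1 ^ (β - 1) * f q)) (fun q => q.1 ^ (β - 1) * pd v f q) Ω :=
    fun q hq => by
      rw [pd_weight_fst hΩo hΩ hf hq, hv, mul_zero, zero_mul, sub_zero]
  rw [pd_congr hΩo h hp, pd_weight_fst hΩo hΩ (contDiffOn_pd hΩo hf v) hp, hw, mul_zero, zero_mul,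
    sub_zero]

lemma pd_pd_weight_snd {v w : ℝ × ℝ × ℝ} (hv : v.2.1 = 0) (hw : w.2.1 = 0) :
    pd w (pd v (fun q => q.2.1 ^ (α - 1) * f q)) p = p.2.1 ^ (α - 1) * pd w (pd v f) p := by
  have h : EqOn (pd v (fun q => q.2.1 ^ (α - 1) * f q)) (fun q => q.2.1 ^ (α - 1) * pd v f q) Ω :=
    fun q hq => by
      rw [pd_weight_snd hΩo hΩ hf hq, hv, mul_zero, zero_mul, sub_zero]
  rw [pd_congr hΩo h hp, pd_weight_snd hΩo hΩ (contDiffOn_pd hΩo hf v) hp, hw, mul_zero, zero_mul,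
    sub_zero]

lemma dY_dY : dY α (dY α f) p = (p.2.1 ^ (1 - α)) ^ 2 *
    (pd (0, 1, 0) (pd (0, 1, 0) f) p + (1 - α) / p.2.1 * pd (0, 1, 0) f p) := by
  rw [dY, pd_dY hΩo hΩ hf hp]
  ring

lemma dU_dY_eq : dU (dY α f) p = p.2.1 ^ (1 - α) * pd (0, 0, 1) (pd (0, 1, 0) f) p := by
  rw [dU, pd_dY hΩo hΩ hf hp]
  simp

lemma dY_weight_snd : dY α (fun q => q.2.1 ^ (α - 1) * f q) p
    = pd (0, 1, 0) f p - (1 - α) / p.2.1 * f p := by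
  have hB := (Real.rpow_pos_of_pos (hΩ p hp).2 (1 - α)).ne'
  rw [dY, pd_weight_snd hΩo hΩ hf hp, rpow_sub_one_eq_inv (hΩ p hp).2]
  field_simp

lemma dU_dY_weight_snd : dU (dY α (fun q => q.2.1 ^ (α - 1) * f q)) p
    = pd (0, 0, 1) (pd (0, 1, 0) f) p - (1 - α) / p.2.1 * pd (0, 0, 1) f p := by
  have h1 : EqOn (dU fun q => q.2.1 ^ (α - 1) * f q) (fun q => q.2.1 ^ (α - 1) * dU f q) Ω :=
    fun q hq => by
      rw [dU, pd_weight_snd hΩo hΩ hf hq]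
      simp [dU]
  rw [dU_dY hΩo hΩ (contDiffOn_weight_snd hΩ hf) hp, dY, pd_congr hΩo h1 hp]
  change dY α (fun q => q.2.1 ^ (α - 1) * dU f q) p = _
  rw [dY_weight_snd hΩo hΩ (f := dU f) (contDiffOn_pd hΩo hf _) hp, dU, pd_comm hΩo hf hp]

lemma dY_dY_weight_snd : dY α (dY α (fun q => q.2.1 ^ (α - 1) * f q)) p
    = p.2.1 ^ (1 - α) * (pd (0, 1, 0) (pd (0, 1, 0) f) p
      - (1 - α) / p.2.1 * pd (0, 1, 0) f p + (1 - α) / p.2.1 ^ 2 * f p) := by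
  -- The quotient by x is written as the power x^(-1), so that the derivative formula for real
  -- powers applies to it.
  have h1 : EqOn (dY α fun q => q.2.1 ^ (α - 1) * f q)
      (fun q => pd (0, 1, 0) f q - (1 - α) * (q.2.1 ^ (-1 : ℝ) * f q)) Ω :=
    fun q hq => by
      dsimp only
      rw [dY_weight_snd hΩo hΩ hf hq, Real.rpow_neg_one]
      ring
  have h2 : HasFDerivAt (fun q => pd (0, 1, 0) f q - (1 - α) * (q.2.1 ^ (-1 : ℝ) * f q)) _ p :=
    (differentiableAt_of_mem hΩo (contDiffOn_pd hΩo hf (0, 1, 0)) hp).hasFDerivAt.sub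
      (((hasFDerivAt_rpow_snd (-1) (hΩ p hp).2).mul
        (differentiableAt_of_mem hΩo hf hp).hasFDerivAt).const_mul (1 - α))
  have hx := (hΩ p hp).2
  rw [dY, pd_congr hΩo h1 hp, pd, h2.fderiv]
  simp [pd, Real.rpow_neg_one]
  left
  field_simp
  ring

end Prolongation

/-- The prolongation of `V`, applied to the left-hand side of the equation, in weighted form. -/
lemma prolongation_eq_weighted {α β a b : ℝ} {Ω : Set (ℝ × ℝ × ℝ)} {p : ℝ × ℝ × ℝ}
    {V : ℝ × ℝ × ℝ → ℝ × ℝ × ℝ} (hΩo : IsOpen Ω) (hΩ : ∀ p ∈ Ω, 0 < p.1 ∧ 0 < p.2.1)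
    (hV : ContDiffOn ℝ ∞ V Ω) (hp : p ∈ Ω) (ut ux utx uxx : ℝ) :
    fderiv ℝ (jetLHS α β a b) (p, ut, ux, uxx)
        (V p, etaT V (p, ut, ux), etaX V (p, ut, ux), etaXX V p ut ux utx uxx) =
      weightedProlongation α β a b (fun q => q.1 ^ (β - 1) * (V q).1)
        (fun q => q.2.1 ^ (α - 1) * (V q).2.1) (fun q => (V q).2.2) p
        (p.1 ^ (1 - β) * ut) (p.2.1 ^ (1 - α) * ux) (p.1 ^ (1 - β) * p.2.1 ^ (1 - α) * utx)
        ((p.2.1 ^ (1 - α)) ^ 2 * (uxx + (1 - α) / p.2.1 * ux)) := by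
  have h1 : ContDiffOn ℝ ∞ (fun q => (V q).1) Ω := hV.fst
  have h2 : ContDiffOn ℝ ∞ (fun q => (V q).2.1) Ω := hV.snd.fst
  have h3 : ContDiffOn ℝ ∞ (fun q => (V q).2.2) Ω := hV.snd.snd
  have hx := (hΩ p hp).2
  have ht := (hΩ p hp).1
  have hA := Real.rpow_pos_of_pos ht (1 - β)
  have hB := Real.rpow_pos_of_pos hx (1 - α)
  have sT := contDiffOn_weight_fst (β := β) hΩ h1
  have sX := contDiffOn_weight_snd (α := α) hΩ h2
  refine (fderiv_jetLHS α β a b ht hx p.2.2 ut ux uxx (V p).1 (V p).2.1 (V p).2.2 _ _ _).trans ?_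
  rw [weightedProlongation, dY_dY hΩo hΩ sT hp, dU_dY_eq hΩo hΩ sT hp, dY_dY hΩo hΩ h3 hp,
    dU_dY_eq hΩo hΩ h3 hp, dY_dY_weight_snd hΩo hΩ h2 hp, dU_dY_weight_snd hΩo hΩ h2 hp,
    dY_weight_snd hΩo hΩ h2 hp]
  simp only [dS, dY, dU]
  rw [pd_pd_weight_fst hΩo hΩ h1 hp rfl rfl, pd_pd_weight_fst hΩo hΩ h1 hp rfl rfl,
    pd_pd_weight_fst hΩo hΩ h1 hp rfl rfl, pd_pd_weight_snd hΩo hΩ h2 hp rfl rfl]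
  simp only [pd_weight_fst hΩo hΩ h1 hp, pd_weight_snd hΩo hΩ h2 hp]
  simp only [etaXX, totalDxJet, fderiv_etaX hΩo hV hp]
  simp only [etaX, etaT, totalDx, totalDt, fderiv_triple, pd_tangent _ _ ux]
  rw [rpow_sub_one_eq_inv ht, rpow_sub_one_eq_inv hx, pd_comm hΩo h1 hp (0, 1, 0) (0, 0, 1),
    pd_comm hΩo h2 hp (0, 1, 0) (0, 0, 1), pd_comm hΩo h3 hp (0, 1, 0) (0, 0, 1)]
  -- All powers are now A, B or their inverses, so the two forms of the prolongation agree by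
  -- rational algebra.
  generalize p.1 ^ (1 - β) = A at *
  generalize p.2.1 ^ (1 - α) = B at *
  field_simp
  ring

/-! ### The general symmetry and the infinitesimal criterion -/

/-- The general infinitesimal symmetry. -/
noncomputable def symField (α β c₁ c₂ c₃ : ℝ) (p : ℝ × ℝ × ℝ) : ℝ × ℝ × ℝ :=
  (-4 * c₁ * p.1 / β + c₂ * p.1 ^ (1 - β), -2 * c₁ * p.2.1 / α + c₃ * p.2.1 ^ (1 - α), c₁ * p.2.2)

section

variable {α β a b c₁ c₂ c₃ : ℝ} {Ω : Set (ℝ × ℝ × ℝ)} {V : ℝ × ℝ × ℝ → ℝ × ℝ × ℝ}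

lemma contDiffOn_symField (hΩ : ∀ p ∈ Ω, 0 < p.1 ∧ 0 < p.2.1) :
    ContDiffOn ℝ ∞ (symField α β c₁ c₂ c₃) Ω := by
  have h1 := contDiffOn_rpow_fst hΩ (1 - β)
  have h2 := contDiffOn_rpow_snd hΩ (1 - α)
  unfold symField
  fun_prop

/-- The common end of both necessity arguments: multiplying T and X by t^(1-β) and x^(1-α) recovers
τ and ξ, because t^(1-β) t^β = t. -/
lemma exists_symField_of_vanishesOnWaves (hα : 0 < α) (hβ : 0 < β) (ha : a ≠ 0) (hb : b ≠ 0)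
    (hΩo : IsOpen Ω) (hΩc : IsConnected Ω) (hΩ : ∀ p ∈ Ω, 0 < p.1 ∧ 0 < p.2.1)
    (hV : ContDiffOn ℝ ∞ V Ω)
    (h : VanishesOnWaves α β a b Ω (fun q => q.1 ^ (β - 1) * (V q).1)
      (fun q => q.2.1 ^ (α - 1) * (V q).2.1) (fun q => (V q).2.2)) :
    ∃ c₁ c₂ c₃ : ℝ, EqOn V (symField α β c₁ c₂ c₃) Ω := by
  obtain ⟨c₁, c₂, c₃, hc⟩ := solve_determining_equations hα hβ ha hb hΩo hΩc hΩ
    (contDiffOn_weight_fst hΩ hV.fst) (contDiffOn_weight_snd hΩ hV.snd.fst) hV.snd.snd h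
  refine ⟨c₁, c₂, c₃, fun p hp => ?_⟩
  obtain ⟨h1, h2, h3⟩ := hc p hp
  obtain ⟨ht, hx⟩ := hΩ p hp
  have e1 := rpow_div_mul_rpow_one_sub (β := β) ht
  have e2 := rpow_div_mul_rpow_one_sub (β := α) hx
  have hA := Real.rpow_pos_of_pos ht (1 - β)
  have hB := Real.rpow_pos_of_pos hx (1 - α)
  rw [rpow_sub_one_eq_inv ht] at h1
  rw [rpow_sub_one_eq_inv hx] at h2
  refine Prod.ext ?_ (Prod.ext ?_ h3) <;> simp only [symField]
  · generalize p.1 ^ (1 - β) = A at *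
    generalize p.1 ^ β = A' at *
    field_simp at h1 e1 ⊢
    linear_combination h1 - 4 * c₁ * e1
  · generalize p.2.1 ^ (1 - α) = A at *
    generalize p.2.1 ^ α = A' at *
    field_simp at h2 e2 ⊢
    linear_combination h2 - 2 * c₁ * e2

variable (hΩo : IsOpen Ω) (hΩ : ∀ p ∈ Ω, 0 < p.1 ∧ 0 < p.2.1)
  (hV : EqOn V (symField α β c₁ c₂ c₃) Ω) {p : ℝ × ℝ × ℝ} (hp : p ∈ Ω)

include hΩo hΩ hV hp

lemma pd_weight_symField_fst (hβ : 0 < β) (v : ℝ × ℝ × ℝ) :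
    pd v (fun q => q.1 ^ (β - 1) * (V q).1) p = -4 * c₁ * (p.1 ^ β / p.1) * v.1 := by
  have h : EqOn (fun q => q.1 ^ (β - 1) * (V q).1) (fun q => c₂ + -4 * c₁ / β * q.1 ^ β) Ω :=
    fun q hq => by
      have ht := (hΩ q hq).1
      have hA := Real.rpow_pos_of_pos ht (1 - β)
      have e1 := rpow_div_mul_rpow_one_sub (β := β) ht
      simp only [hV hq, symField, rpow_sub_one_eq_inv ht]
      generalize q.1 ^ (1 - β) = A at *
      field_simp at e1 ⊢
      linear_combination 4 * c₁ * e1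
  have h2 : HasFDerivAt (fun q : ℝ × ℝ × ℝ => c₂ + -4 * c₁ / β * q.1 ^ β) _ p :=
    ((hasFDerivAt_rpow_fst β (hΩ p hp).1).const_mul (-4 * c₁ / β)).const_add c₂
  rw [pd_congr hΩo h hp, pd, h2.fderiv]
  simp
  field_simp

lemma pd_weight_symField_snd (hα : 0 < α) (v : ℝ × ℝ × ℝ) :
    pd v (fun q => q.2.1 ^ (α - 1) * (V q).2.1) p = -2 * c₁ * (p.2.1 ^ α / p.2.1) * v.2.1 := by
  have h : EqOn (fun q => q.2.1 ^ (α - 1) * (V q).2.1)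
      (fun q => c₃ + -2 * c₁ / α * q.2.1 ^ α) Ω :=
    fun q hq => by
      have ht := (hΩ q hq).2
      have hA := Real.rpow_pos_of_pos ht (1 - α)
      have e1 := rpow_div_mul_rpow_one_sub (β := α) ht
      simp only [hV hq, symField, rpow_sub_one_eq_inv ht]
      generalize q.2.1 ^ (1 - α) = A at *
      field_simp at e1 ⊢
      linear_combination 2 * c₁ * e1
  have h2 : HasFDerivAt (fun q : ℝ × ℝ × ℝ => c₃ + -2 * c₁ / α * q.2.1 ^ α) _ p :=
    ((hasFDerivAt_rpow_snd α (hΩ p hp).2).const_mul (-2 * c₁ / α)).const_add c₃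
  rw [pd_congr hΩo h hp, pd, h2.fderiv]
  simp
  field_simp

omit hΩ in
lemma pd_symField_u (v : ℝ × ℝ × ℝ) : pd v (fun q => (V q).2.2) p = c₁ * v.2.2 := by
  have h : EqOn (fun q => (V q).2.2) (fun q => c₁ * q.2.2) Ω := fun q hq => by
    simp only [hV hq, symField]
  have h2 : HasFDerivAt (fun q : ℝ × ℝ × ℝ => c₁ * q.2.2) _ p :=
    (((ContinuousLinearMap.snd ℝ ℝ ℝ).comp
      (ContinuousLinearMap.snd ℝ ℝ (ℝ × ℝ))).hasFDerivAt (x := p)).const_mul c₁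
  rw [pd_congr hΩo h hp, pd, h2.fderiv]
  simp

/-- Here T_s = -4c₁, X_y = -2c₁, η_u = c₁, and the other first derivatives and all second
derivatives vanish. The three terms of the equation have the same weight: 1 + 4 = (2 + 1) + 2 = 1 +
2·2 = 5. -/
lemma weightedProlongation_symField (hα : 0 < α) (hβ : 0 < β) (q P m r : ℝ) :
    weightedProlongation α β a b (fun q => q.1 ^ (β - 1) * (V q).1)
      (fun q => q.2.1 ^ (α - 1) * (V q).2.1) (fun q => (V q).2.2) p q P m r =
      5 * c₁ * (q + a * p.2.2 ^ 2 * P + b * r) := by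
  set T : ℝ × ℝ × ℝ → ℝ := fun q => q.1 ^ (β - 1) * (V q).1
  set X : ℝ × ℝ × ℝ → ℝ := fun q => q.2.1 ^ (α - 1) * (V q).2.1
  set η : ℝ × ℝ × ℝ → ℝ := fun q => (V q).2.2
  have hT := fun q (hq : q ∈ Ω) v => pd_weight_symField_fst hΩo hΩ hV hq hβ v
  have hX := fun q (hq : q ∈ Ω) v => pd_weight_symField_snd hΩo hΩ hV hq hα v
  have hη := fun q (hq : q ∈ Ω) v => pd_symField_u hΩo hV hq v
  have const : ∀ {f : ℝ × ℝ × ℝ → ℝ} (k : ℝ), (∀ q ∈ Ω, f q = k) → ∀ v, pd v f p = 0 :=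
    fun k h v => by
      rw [pd_congr (g := fun _ => k) hΩo (fun q hq => h q hq) hp]
      simp [pd]
  have t1 : dS β T p = -4 * c₁ := by
    rw [dS, hT p hp]
    linear_combination -4 * c₁ * rpow_div_mul_rpow_one_sub (β := β) (hΩ p hp).1
  have t2 : ∀ q ∈ Ω, dY α T q = 0 := fun q hq => by rw [dY, hT q hq]; simp
  have t3 : ∀ q ∈ Ω, dU T q = 0 := fun q hq => by rw [dU, hT q hq]; simp
  have x1 : dS β X p = 0 := by rw [dS, hX p hp]; simp
  have x2 : ∀ q ∈ Ω, dY α X q = -2 * c₁ := fun q hq => by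
    rw [dY, hX q hq]
    linear_combination -2 * c₁ * rpow_div_mul_rpow_one_sub (β := α) (hΩ q hq).2
  have x3 : ∀ q ∈ Ω, dU X q = 0 := fun q hq => by rw [dU, hX q hq]; simp
  have n1 : dS β η p = 0 := by rw [dS, hη p hp]; simp
  have n2 : ∀ q ∈ Ω, dY α η q = 0 := fun q hq => by rw [dY, hη q hq]; simp
  have n3 : ∀ q ∈ Ω, dU η q = c₁ := fun q hq => by rw [dU, hη q hq]; simp
  have y : ∀ {f : ℝ × ℝ × ℝ → ℝ} (k : ℝ), (∀ q ∈ Ω, f q = k) → dY α f p = 0 :=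
    fun k h => by rw [dY, const k h, mul_zero]
  have z : ∀ {f : ℝ × ℝ × ℝ → ℝ} (k : ℝ), (∀ q ∈ Ω, f q = k) → dU f p = 0 :=
    fun k h => const k h _
  rw [weightedProlongation, t1, t2 p hp, t3 p hp, x1, x2 p hp, x3 p hp, n1, n2 p hp, n3 p hp,
    y _ t2, z _ t2, z _ t3, y _ x2, z _ x2, z _ x3, y _ n2, z _ n2, z _ n3]
  simp only [η, hV hp, symField]
  ring

end

lemma jetLHS_eq_weighted {α β a b : ℝ} {p : ℝ × ℝ × ℝ} (hx : 0 < p.2.1) (ut ux uxx : ℝ) :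
    jetLHS α β a b (p, ut, ux, uxx) = p.1 ^ (1 - β) * ut
      + a * p.2.2 ^ 2 * (p.2.1 ^ (1 - α) * ux)
      + b * ((p.2.1 ^ (1 - α)) ^ 2 * (uxx + (1 - α) / p.2.1 * ux)) := by
  refine (jetLHS_eq (t := p.1) (u := p.2.2) hx).trans ?_
  ring

theorem lieCondition_iff {α β a b : ℝ} (hα : 0 < α) (hβ : 0 < β) (ha : a ≠ 0) (hb : b ≠ 0)
    {Ω : Set (ℝ × ℝ × ℝ)} (hΩo : IsOpen Ω) (hΩc : IsConnected Ω)
    (hΩ : ∀ p ∈ Ω, 0 < p.1 ∧ 0 < p.2.1) (V : ℝ × ℝ × ℝ → ℝ × ℝ × ℝ) :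
    LieCondition α β a b Ω V ↔ ∃ c₁ c₂ c₃ : ℝ, EqOn V (symField α β c₁ c₂ c₃) Ω := by
  constructor
  · rintro ⟨hV, h⟩
    refine exists_symField_of_vanishesOnWaves hα hβ ha hb hΩo hΩc hΩ hV fun p hp c P => ?_
    have hA := Real.rpow_pos_of_pos (hΩ p hp).1 (1 - β)
    have hx := (hΩ p hp).2
    have hB := Real.rpow_pos_of_pos hx (1 - α)
    set A := p.1 ^ (1 - β) with hAd
    set B := p.2.1 ^ (1 - α) with hBd
    set r := P * (c - a * p.2.2 ^ 2) / b with hr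
    have hr' : b * r = P * (c - a * p.2.2 ^ 2) := by rw [hr]; field_simp
    have e1 : A * (-c * P / A) = -c * P := by field_simp
    have e2 : B * (P / B) = P := by field_simp
    have e3 : A * B * (-c * r / (A * B)) = -c * r := by field_simp
    have e4 : B ^ 2 * (r / B ^ 2 - (1 - α) / p.2.1 * (P / B) + (1 - α) / p.2.1 * (P / B)) = r := by
      field_simp
      ring
    -- The weighted jet of a travelling wave, converted to ordinary derivatives by dividing out A
    -- and B.
    have h1 := h p hp (-c * P / A) (P / B) (-c * r / (A * B))
      (r / B ^ 2 - (1 - α) / p.2.1 * (P / B)) (by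
        rw [jetLHS_eq_weighted hx, ← hAd, ← hBd, e1, e2, e4, hr']
        ring)
    rwa [prolongation_eq_weighted hΩo hΩ hV hp, ← hAd, ← hBd, e1, e2, e3, e4] at h1
  · rintro ⟨c₁, c₂, c₃, hc⟩
    have hV : ContDiffOn ℝ ∞ V Ω := (contDiffOn_symField hΩ).congr hc
    refine ⟨hV, fun p hp ut ux utx uxx h => ?_⟩
    rw [jetLHS_eq_weighted (hΩ p hp).2] at h
    rw [prolongation_eq_weighted hΩo hΩ hV hp, weightedProlongation_symField hΩo hΩ hc hp hα hβ, h,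
      mul_zero]

/-! ### The scaling and translation symmetries -/

/-- The change of variable which becomes affine in terms of `t^γ`. -/
noncomputable def powerAffine (γ m s t : ℝ) : ℝ := (m * (t ^ γ - s)) ^ γ⁻¹

section PowerAffine

variable {γ m s t : ℝ} (hγ : 0 < γ) (ht : 0 < t) (hpos : 0 < m * (t ^ γ - s))
include hγ ht hpos

lemma hasDerivAt_powerAffine :
    HasDerivAt (powerAffine γ m s) (m * (t ^ γ / t) * powerAffine γ m s t ^ (1 - γ)) t := by
  have h1 : HasDerivAt (fun t : ℝ => m * (t ^ γ - s)) (m * (γ * t ^ (γ - 1))) t :=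
    ((Real.hasDerivAt_rpow_const (Or.inl ht.ne')).sub_const s).const_mul m
  have h2 := h1.rpow_const (p := γ⁻¹) (Or.inl hpos.ne')
  refine h2.congr_deriv ?_
  rw [powerAffine, ← Real.rpow_mul hpos.le, show γ⁻¹ * (1 - γ) = γ⁻¹ - 1 by field_simp,
    Real.rpow_sub_one ht.ne']
  field_simp

/-- The conformable derivative is differentiation in t^γ/γ, and in t^γ the substitution is affine
with slope m. The chain rule therefore produces only the factor m. -/
lemma confDeriv_comp_powerAffine {f : ℝ → ℝ} (l : ℝ)
    (hf : DifferentiableAt ℝ f (powerAffine γ m s t)) :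
    confDeriv γ (fun r => l * f (powerAffine γ m s r)) t
      = l * m * confDeriv γ f (powerAffine γ m s t) := by
  have h : HasDerivAt (fun r => l * f (powerAffine γ m s r)) _ t :=
    (hf.hasDerivAt.comp t (hasDerivAt_powerAffine hγ ht hpos)).const_mul l
  rw [confDeriv_eq_of_hasDerivAt hf.hasDerivAt, confDeriv_eq_of_hasDerivAt h]
  linear_combination (l * m * powerAffine γ m s t ^ (1 - γ) * deriv f (powerAffine γ m s t)) *
    rpow_div_mul_rpow_one_sub (β := γ) ht

end PowerAffine

lemma differentiableAt_confDeriv_snd {α : ℝ} {D : Set (ℝ × ℝ)} {u : ℝ × ℝ → ℝ} {t x : ℝ}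
    (hD : IsOpen D) (hu : ContDiffOn ℝ ∞ u D) (h : (t, x) ∈ D) (hx : 0 < x) :
    DifferentiableAt ℝ (fun y => confDeriv α (fun z => u (t, z)) y) x := by
  have h1 : (fun y => confDeriv α (fun z => u (t, z)) y) =ᶠ[𝓝 x]
      fun y => y ^ (1 - α) * pd (0, 1) u (t, y) := by
    filter_upwards [eventually_mem_snd hD h] with y hy
    exact confDeriv_eq_of_hasDerivAt (hasDerivAt_snd hD hu hy)
  exact (((hasDerivAt_rpow_one_sub hx).fun_mul
    (hasDerivAt_snd hD (contDiffOn_pd hD hu (0, 1)) h)).congr_of_eventuallyEq h1).differentiableAt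

/-- Scalings combined with translations of `t^β` and `x^α` map solutions to solutions. -/
lemma mapsSolutions_scaling {α β a b l σ ρ : ℝ} (hα : 0 < α) (hβ : 0 < β)
    {N : Set (ℝ × ℝ × ℝ)} (hN : ∀ p ∈ N, 0 < p.1 ∧ 0 < p.2.1)
    {Ψ : ℝ × ℝ × ℝ → ℝ × ℝ × ℝ}
    (hΨ : ∀ p ∈ N, 0 < (Ψ p).1 ∧ 0 < (Ψ p).2.1 ∧ l ^ 4 * ((Ψ p).1 ^ β - σ) = p.1 ^ β ∧
      l ^ 2 * ((Ψ p).2.1 ^ α - ρ) = p.2.1 ^ α ∧ (Ψ p).2.2 = l * p.2.2) :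
    MapsSolutions α β a b N Ψ := by
  intro D u D' u' hD hu hDN hD' hu' hgr
  -- The conditions on Ψ determine the preimage of a point of the new graph, so u' is u after an
  -- explicit change of variables, times l.
  have key : ∀ t x : ℝ, (t, x) ∈ D' → (0 < t ∧ 0 < x) ∧
      (0 < l ^ 4 * (t ^ β - σ) ∧ 0 < l ^ 2 * (x ^ α - ρ)) ∧
      (powerAffine β (l ^ 4) σ t, powerAffine α (l ^ 2) ρ x) ∈ D ∧
      0 < powerAffine α (l ^ 2) ρ x ∧
      u' (t, x) = l * u (powerAffine β (l ^ 4) σ t, powerAffine α (l ^ 2) ρ x) := by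
    intro t' x' h'
    have h1 : (t', x', u' (t', x')) ∈ Ψ '' graphOver D u := hgr ▸ ⟨(t', x'), h', rfl⟩
    obtain ⟨_, ⟨⟨t, x⟩, htx, rfl⟩, he⟩ := h1
    have hmem : (t, x, u (t, x)) ∈ N := hDN ⟨(t, x), htx, rfl⟩
    obtain ⟨k1, k2, k3, k4, k5⟩ := hΨ _ hmem
    obtain ⟨ht, hx⟩ := hN _ hmem
    simp only [he] at k1 k2 k3 k4 k5 ht hx
    have e1 : powerAffine β (l ^ 4) σ t' = t := by
      rw [powerAffine, k3, ← Real.rpow_mul ht.le, mul_inv_cancel₀ hβ.ne', Real.rpow_one]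
    have e2 : powerAffine α (l ^ 2) ρ x' = x := by
      rw [powerAffine, k4, ← Real.rpow_mul hx.le, mul_inv_cancel₀ hα.ne', Real.rpow_one]
    rw [e1, e2, k3, k4]
    exact ⟨⟨k1, k2⟩, ⟨Real.rpow_pos_of_pos ht _, Real.rpow_pos_of_pos hx _⟩, htx, hx, k5⟩
  refine ⟨hu', fun t x h => ?_⟩
  obtain ⟨⟨ht, hx⟩, ⟨hpt, hpx⟩, hmem, hxp, he⟩ := key t x h
  have h1 : confDeriv β (fun s => u' (s, x)) t = l * l ^ 4 *
      confDeriv β (fun s => u (s, powerAffine α (l ^ 2) ρ x)) (powerAffine β (l ^ 4) σ t) := by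
    rw [← confDeriv_comp_powerAffine hβ ht hpt l (hasDerivAt_fst hD hu.1 hmem).differentiableAt]
    refine confDeriv_congr ?_
    filter_upwards [eventually_mem_fst hD' h] with s hs using (key s x hs).2.2.2.2
  have h2 : ∀ y, (t, y) ∈ D' → confDeriv α (fun z => u' (t, z)) y = l * l ^ 2 *
      confDeriv α (fun z => u (powerAffine β (l ^ 4) σ t, z)) (powerAffine α (l ^ 2) ρ y) := by
    intro y hy
    obtain ⟨⟨-, hy0⟩, ⟨-, hpy⟩, hm, -, -⟩ := key t y hy
    rw [← confDeriv_comp_powerAffine hα hy0 hpy l (hasDerivAt_snd hD hu.1 hm).differentiableAt]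
    refine confDeriv_congr ?_
    filter_upwards [eventually_mem_snd hD' hy] with z hz using (key t z hz).2.2.2.2
  have h3 : confDeriv α (fun y => confDeriv α (fun z => u' (t, z)) y) x = l * l ^ 2 * l ^ 2 *
      confDeriv α (fun y => confDeriv α (fun z => u (powerAffine β (l ^ 4) σ t, z)) y)
        (powerAffine α (l ^ 2) ρ x) := by
    rw [← confDeriv_comp_powerAffine hα hx hpx (l * l ^ 2)
      (differentiableAt_confDeriv_snd hD hu.1 hmem hxp)]
    refine confDeriv_congr ?_
    filter_upwards [eventually_mem_snd hD' h] with y hy using h2 y hy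
  have h4 := hu.2 _ _ hmem
  rw [h1, h2 x h, h3, he]
  linear_combination l ^ 5 * h4

/-! ### The flow of the general symmetry -/

/-- The function g(ε) is the integral of exp(-kσ) from 0 to ε; k = 0 is separate because the closed
form divides by k. -/
lemma exists_flow_factor (k : ℝ) : ∃ g : ℝ → ℝ, ContDiff ℝ ∞ g ∧ g 0 = 0 ∧
    (∀ ε, HasDerivAt g (Real.exp (-k * ε)) ε) ∧ ∀ ε, 1 - k * g ε = Real.exp (-k * ε) := by
  rcases eq_or_ne k 0 with rfl | hk
  · exact ⟨id, contDiff_id, rfl, fun ε => by simpa using hasDerivAt_id ε, fun ε => by simp⟩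
  · refine ⟨fun ε => (1 - Real.exp (-k * ε)) / k, by fun_prop, by simp, fun ε => ?_, fun ε => ?_⟩
    · have h : HasDerivAt (fun ε : ℝ => -k * ε) (-k) ε := by
        simpa using (hasDerivAt_id ε).const_mul (-k)
      refine ((h.exp.const_sub 1).div_const k).congr_deriv ?_
      field_simp
    · field_simp
      ring

/-- The Bernoulli equation t' = -k t/γ + c t^(1-γ) becomes y' = -k y + γ c for y = t^γ, and
variation of constants solves it. -/
lemma hasDerivAt_powerFlow {γ k c t ε : ℝ} {g : ℝ → ℝ} (hγ : 0 < γ)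
    (hg : ∀ ε, HasDerivAt g (Real.exp (-k * ε)) ε) (hg' : ∀ ε, 1 - k * g ε = Real.exp (-k * ε))
    (hpos : 0 < Real.exp (-k * ε) * t ^ γ + γ * c * g ε) :
    HasDerivAt (fun ε => (Real.exp (-k * ε) * t ^ γ + γ * c * g ε) ^ γ⁻¹)
      (-k * (Real.exp (-k * ε) * t ^ γ + γ * c * g ε) ^ γ⁻¹ / γ
        + c * ((Real.exp (-k * ε) * t ^ γ + γ * c * g ε) ^ γ⁻¹) ^ (1 - γ)) ε := by
  have h : HasDerivAt (fun ε : ℝ => -k * ε) (-k) ε := by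
    simpa using (hasDerivAt_id ε).const_mul (-k)
  have h1 := ((h.exp.mul_const (t ^ γ)).fun_add ((hg ε).const_mul (γ * c))).rpow_const
    (p := γ⁻¹) (Or.inl hpos.ne')
  refine h1.congr_deriv ?_
  have e := hg' ε
  rw [← Real.rpow_mul hpos.le, show γ⁻¹ * (1 - γ) = γ⁻¹ - 1 by field_simp,
    Real.rpow_sub_one hpos.ne']
  generalize t ^ γ = T at *
  generalize hY : Real.exp (-k * ε) * T + γ * c * g ε = Y at *
  have key : Real.exp (-k * ε) * -k * T + γ * c * Real.exp (-k * ε) = -k * Y + γ * c := by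
    rw [← hY]
    linear_combination -(γ * c) * e
  rw [key]
  field_simp

lemma generatesSymmetries_of_eqOn {α β a b c₁ c₂ c₃ : ℝ} (hα : 0 < α) (hβ : 0 < β)
    {Ω : Set (ℝ × ℝ × ℝ)} (hΩo : IsOpen Ω) (hΩ : ∀ p ∈ Ω, 0 < p.1 ∧ 0 < p.2.1)
    {V : ℝ × ℝ × ℝ → ℝ × ℝ × ℝ} (hV : EqOn V (symField α β c₁ c₂ c₃) Ω) :
    GeneratesSymmetries α β a b Ω V := by
  refine ⟨(contDiffOn_symField hΩ).congr hV, fun p hp => ?_⟩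
  obtain ⟨g, gs, g0, gd, ge⟩ := exists_flow_factor (4 * c₁)
  obtain ⟨h, hs, h0, hd, he⟩ := exists_flow_factor (2 * c₁)
  let y₁ : ℝ × ℝ × ℝ × ℝ → ℝ := fun z =>
    Real.exp (-(4 * c₁) * z.1) * z.2.1 ^ β + β * c₂ * g z.1
  let y₂ : ℝ × ℝ × ℝ × ℝ → ℝ := fun z =>
    Real.exp (-(2 * c₁) * z.1) * z.2.2.1 ^ α + α * c₃ * h z.1
  let Φ : ℝ × ℝ × ℝ × ℝ → ℝ × ℝ × ℝ := fun z =>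
    (y₁ z ^ β⁻¹, y₂ z ^ α⁻¹, Real.exp (c₁ * z.1) * z.2.2.2)
  have hy₁ : ContDiffOn ℝ ∞ y₁ {z | z.2 ∈ Ω} := by
    have h1 : ContDiffOn ℝ ∞ (fun z : ℝ × ℝ × ℝ × ℝ => z.2.1 ^ β) {z | z.2 ∈ Ω} :=
      contDiffOn_snd.fst.rpow_const_of_ne fun z hz => (hΩ z.2 hz).1.ne'
    have h2 := (gs.comp (contDiff_fst (E := ℝ) (F := ℝ × ℝ × ℝ))).contDiffOn (s := {z | z.2 ∈ Ω})
    have h3 : ContDiffOn ℝ ∞ (fun z : ℝ × ℝ × ℝ × ℝ => Real.exp (-(4 * c₁) * z.1))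
      {z | z.2 ∈ Ω} := by fun_prop
    exact (h3.mul h1).add (contDiffOn_const.mul h2)
  have hy₂ : ContDiffOn ℝ ∞ y₂ {z | z.2 ∈ Ω} := by
    have h1 : ContDiffOn ℝ ∞ (fun z : ℝ × ℝ × ℝ × ℝ => z.2.2.1 ^ α) {z | z.2 ∈ Ω} :=
      contDiffOn_snd.snd.fst.rpow_const_of_ne fun z hz => (hΩ z.2 hz).2.ne'
    have h2 := (hs.comp (contDiff_fst (E := ℝ) (F := ℝ × ℝ × ℝ))).contDiffOn (s := {z | z.2 ∈ Ω})
    have h3 : ContDiffOn ℝ ∞ (fun z : ℝ × ℝ × ℝ × ℝ => Real.exp (-(2 * c₁) * z.1))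
      {z | z.2 ∈ Ω} := by fun_prop
    exact (h3.mul h1).add (contDiffOn_const.mul h2)
  have hO : IsOpen {z : ℝ × ℝ × ℝ × ℝ | z.2 ∈ Ω} := hΩo.preimage continuous_snd
  -- The formula for the flow is smooth where both affine expressions are positive. At ε = 0 they
  -- are t^β and x^α, so this open set contains (0, p), and a product neighbourhood can be chosen
  -- that also keeps the flow inside Ω.
  have hO₁ : IsOpen ({z : ℝ × ℝ × ℝ × ℝ | z.2 ∈ Ω} ∩ (fun z => (y₁ z, y₂ z)) ⁻¹' (Ioi 0 ×ˢ Ioi 0)) :=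
    (hy₁.continuousOn.prodMk hy₂.continuousOn).isOpen_inter_preimage hO (isOpen_Ioi.prod isOpen_Ioi)
  set O₁ := {z : ℝ × ℝ × ℝ × ℝ | z.2 ∈ Ω} ∩ (fun z => (y₁ z, y₂ z)) ⁻¹' (Ioi 0 ×ˢ Ioi 0)
  have hΦ : ContDiffOn ℝ ∞ Φ O₁ := by
    refine ContDiffOn.prodMk ((hy₁.mono inter_subset_left).rpow_const_of_ne fun z hz => ?_)
      (ContDiffOn.prodMk ((hy₂.mono inter_subset_left).rpow_const_of_ne fun z hz => ?_) ?_)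
    · exact (hz.2.1 : 0 < y₁ z).ne'
    · exact (hz.2.2 : 0 < y₂ z).ne'
    · fun_prop
  have hO₂ : IsOpen (O₁ ∩ Φ ⁻¹' Ω) := hΦ.continuousOn.isOpen_inter_preimage hO₁ hΩo
  have hΦ0 : ∀ q ∈ Ω, y₁ (0, q) = q.1 ^ β ∧ y₂ (0, q) = q.2.1 ^ α ∧ Φ (0, q) = q := fun q hq => by
    have e1 : y₁ (0, q) = q.1 ^ β := by simp [y₁, g0]
    have e2 : y₂ (0, q) = q.2.1 ^ α := by simp [y₂, h0]
    refine ⟨e1, e2, ?_⟩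
    simp only [Φ, e1, e2]
    rw [← Real.rpow_mul (hΩ q hq).1.le, ← Real.rpow_mul (hΩ q hq).2.le, mul_inv_cancel₀ hβ.ne',
      mul_inv_cancel₀ hα.ne', Real.rpow_one, Real.rpow_one]
    simp
  have hmem : ((0 : ℝ), p) ∈ O₁ ∩ Φ ⁻¹' Ω := by
    obtain ⟨e1, e2, e3⟩ := hΦ0 p hp
    refine ⟨⟨hp, ?_, ?_⟩, ?_⟩
    · simpa [e1] using Real.rpow_pos_of_pos (hΩ p hp).1 _
    · simpa [e2] using Real.rpow_pos_of_pos (hΩ p hp).2 _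
    · rw [mem_preimage, e3]
      exact hp
  obtain ⟨U, N, hU, hN, h0U, hpN, hsub⟩ := isOpen_prod_iff.1 hO₂ 0 p hmem
  obtain ⟨δ, hδ, hball⟩ := Metric.isOpen_iff.1 hU 0 h0U
  rw [Real.ball_eq_Ioo, zero_sub, zero_add] at hball
  have hin : ∀ ε ∈ Ioo (-δ) δ, ∀ q ∈ N, (ε, q) ∈ O₁ ∩ Φ ⁻¹' Ω := fun ε hε q hq =>
    hsub ⟨hball hε, hq⟩
  have hNΩ : N ⊆ Ω := fun q hq => (hsub (mk_mem_prod h0U hq)).1.1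
  refine ⟨δ, hδ, N, hN, hpN, hNΩ, fun ε q => Φ (ε, q), ?_, fun q hq => (hΦ0 q (hNΩ hq)).2.2,
    fun ε hε q hq => ⟨(hin ε hε q hq).2, ?_⟩, fun ε hε => ?_⟩
  · exact hΦ.mono fun z hz => (hin z.1 hz.1 z.2 hz.2).1
  · have h1 := hin ε hε q hq
    rw [hV h1.2]
    refine HasDerivAt.prodMk ?_ (HasDerivAt.prodMk ?_ ?_)
    · refine (hasDerivAt_powerFlow hβ gd ge h1.1.2.1).congr_deriv ?_
      simp only [Φ, y₁]
      ring
    · refine (hasDerivAt_powerFlow hα hd he h1.1.2.2).congr_deriv ?_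
      simp only [Φ, y₂]
      ring
    · have h : HasDerivAt (fun ε : ℝ => c₁ * ε) c₁ ε := by
        simpa using (hasDerivAt_id ε).const_mul c₁
      refine (h.exp.mul_const q.2.2).congr_deriv ?_
      simp only [Φ]
      ring
  · refine mapsSolutions_scaling (l := Real.exp (c₁ * ε)) (σ := β * c₂ * g ε) (ρ := α * c₃ * h ε)
      hα hβ (fun q hq => hΩ q (hNΩ hq)) fun q hq => ?_
    obtain ⟨⟨-, h1, h2⟩, h3⟩ := hin ε hε q hq
    have h1 : 0 < y₁ (ε, q) := h1
    have h2 : 0 < y₂ (ε, q) := h2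
    refine ⟨(hΩ _ h3).1, (hΩ _ h3).2, ?_, ?_, rfl⟩
    · simp only [Φ]
      rw [← Real.rpow_mul h1.le, inv_mul_cancel₀ hβ.ne', Real.rpow_one, ← Real.exp_nat_mul]
      simp only [y₁, add_sub_cancel_right]
      rw [← mul_assoc, ← Real.exp_add]
      push_cast
      ring_nf
      simp
    · simp only [Φ]
      rw [← Real.rpow_mul h2.le, inv_mul_cancel₀ hα.ne', Real.rpow_one, ← Real.exp_nat_mul]
      simp only [y₂, add_sub_cancel_right]
      rw [← mul_assoc, ← Real.exp_add]
      push_cast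
      ring_nf
      simp

/-! ### Travelling waves -/

/-- The right-hand side of the equation `f' = G (f)` for the profile of a travelling wave of
velocity `c`, normalized by `G u₀ = P`. -/
noncomputable def waveRate (a b c u₀ P v : ℝ) : ℝ :=
  P + (c * (v - u₀) - a * (v ^ 3 - u₀ ^ 3) / 3) / b

lemma waveRate_self (a b c u₀ P : ℝ) : waveRate a b c u₀ P u₀ = P := by simp [waveRate]

lemma contDiff_waveRate (a b c u₀ P : ℝ) : ContDiff ℝ ∞ (waveRate a b c u₀ P) := by
  unfold waveRate
  fun_prop

/-- With f' = G(f) this yields b f'' = (c - a f²) f', the equation of a wave profile; G is its first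
integral. -/
lemma hasDerivAt_waveRate (a b c u₀ P v : ℝ) :
    HasDerivAt (waveRate a b c u₀ P) ((c - a * v ^ 2) / b) v := by
  have h := (((((hasDerivAt_id v).sub_const u₀).const_mul c).fun_sub
    (((((hasDerivAt_id v).fun_pow 3).sub_const (u₀ ^ 3)).const_mul a).div_const 3)).div_const
      b).const_add P
  refine h.congr_deriv ?_
  simp
  ring

/-- Integral curves of smooth functions on the line are smooth. -/
lemma contDiffOn_of_hasDerivAt {G f : ℝ → ℝ} {I : Set ℝ} (hI : IsOpen I) (hG : ContDiff ℝ ∞ G)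
    (hf : ∀ z ∈ I, HasDerivAt f (G (f z)) z) : ContDiffOn ℝ ∞ f I := by
  have hd : DifferentiableOn ℝ f I := fun z hz => (hf z hz).differentiableAt.differentiableWithinAt
  rw [contDiffOn_infty]
  intro n
  induction n with
  | zero => exact contDiffOn_zero.2 hd.continuousOn
  | succ n ih =>
    push_cast
    rw [contDiffOn_succ_iff_deriv_of_isOpen hI]
    refine ⟨hd, by simp, ?_⟩
    exact ((hG.of_le (by exact_mod_cast le_top)).comp_contDiffOn ih).congr
      fun z hz => (hf z hz).deriv

lemma exists_waveProfile (a b c u₀ P z₀ : ℝ) : ∃ f : ℝ → ℝ, f z₀ = u₀ ∧ ∃ I : Set ℝ, IsOpen I ∧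
    z₀ ∈ I ∧ ContDiffOn ℝ ∞ f I ∧ ∀ z ∈ I, HasDerivAt f (waveRate a b c u₀ P (f z)) z := by
  obtain ⟨f, hf0, ε, hε, hf⟩ :=
    ((contDiff_waveRate a b c u₀ P).contDiffAt (x := u₀)).of_le
      (by exact_mod_cast le_top)
      |>.exists_forall_mem_closedBall_exists_eq_forall_mem_Ioo_hasDerivAt₀ z₀
  exact ⟨f, hf0, Ioo (z₀ - ε) (z₀ + ε), isOpen_Ioo, by simp [hε],
    contDiffOn_of_hasDerivAt isOpen_Ioo (contDiff_waveRate a b c u₀ P) hf, hf⟩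

/-- Through every point there is a travelling wave solution, with prescribed velocity and
slope. -/
lemma exists_wave (α β a b : ℝ) (hb : b ≠ 0) (hα : 0 < α) (hβ : 0 < β) {p : ℝ × ℝ × ℝ}
    (ht : 0 < p.1) (hx : 0 < p.2.1) (c P : ℝ) {N : Set (ℝ × ℝ × ℝ)} (hN : IsOpen N) (hp : p ∈ N) :
    ∃ (D : Set (ℝ × ℝ)) (u : ℝ × ℝ → ℝ), IsOpen D ∧ (p.1, p.2.1) ∈ D ∧ IsSolutionOn α β a b D u ∧
      u (p.1, p.2.1) = p.2.2 ∧ (∀ q ∈ D, 0 < q.1 ∧ 0 < q.2) ∧ (∀ q ∈ D, (q.1, q.2, u q) ∈ N) ∧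
      (∀ t x, (t, x) ∈ D → HasDerivAt (fun s => u (s, x))
        (-c * waveRate a b c p.2.2 P (u (t, x)) * t ^ (β - 1)) t) ∧
      ∀ t x, (t, x) ∈ D → HasDerivAt (fun y => u (t, y))
        (waveRate a b c p.2.2 P (u (t, x)) * x ^ (α - 1)) x := by
  set G := waveRate a b c p.2.2 P
  obtain ⟨f, hf0, I, hI, hzI, hfs, hf⟩ := exists_waveProfile a b c p.2.2 P
    (p.2.1 ^ α / α - c * (p.1 ^ β / β))
  let z : ℝ × ℝ → ℝ := fun q => q.2 ^ α / α - c * (q.1 ^ β / β)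
  have hz : Continuous z := by
    have h1 : Continuous fun q : ℝ × ℝ => q.2 ^ α :=
      (Real.continuous_rpow_const hα.le).comp continuous_snd
    have h2 : Continuous fun q : ℝ × ℝ => q.1 ^ β :=
      (Real.continuous_rpow_const hβ.le).comp continuous_fst
    fun_prop
  let D₁ : Set (ℝ × ℝ) := (Ioi 0 ×ˢ Ioi 0) ∩ z ⁻¹' I
  have hD₁ : IsOpen D₁ := (isOpen_Ioi.prod isOpen_Ioi).inter (hI.preimage hz)
  have hu : ContDiffOn ℝ ∞ (fun q => f (z q)) D₁ := by
    have h1 : ContDiffOn ℝ ∞ (fun q : ℝ × ℝ => q.2 ^ α) D₁ :=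
      contDiffOn_snd.rpow_const_of_ne fun q hq => (hq.1.2 : 0 < q.2).ne'
    have h2 : ContDiffOn ℝ ∞ (fun q : ℝ × ℝ => q.1 ^ β) D₁ :=
      contDiffOn_fst.rpow_const_of_ne fun q hq => (hq.1.1 : 0 < q.1).ne'
    exact hfs.comp (by fun_prop) fun q hq => hq.2
  have hD : IsOpen (D₁ ∩ (fun q => (q.1, q.2, f (z q))) ⁻¹' N) :=
    (continuousOn_fst.prodMk (continuousOn_snd.prodMk hu.continuousOn)).isOpen_inter_preimage hD₁ hN
  have hdt : ∀ t x, (t, x) ∈ D₁ → HasDerivAt (fun s => f (z (s, x)))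
      (-c * G (f (z (t, x))) * t ^ (β - 1)) t := fun t x h => by
    have h1 : HasDerivAt (fun s => z (s, x)) (-(c * (β * t ^ (β - 1) / β))) t :=
      ((((Real.hasDerivAt_rpow_const (Or.inl (h.1.1 : 0 < t).ne')).div_const β).const_mul
        c).const_sub (x ^ α / α))
    refine ((hf _ h.2).comp t h1).congr_deriv ?_
    simp only [G]
    field_simp
  have hdx : ∀ t x, (t, x) ∈ D₁ → HasDerivAt (fun y => f (z (t, y)))
      (G (f (z (t, x))) * x ^ (α - 1)) x := fun t x h => by
    have h1 : HasDerivAt (fun y => z (t, y)) (α * x ^ (α - 1) / α) x :=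
      ((Real.hasDerivAt_rpow_const (Or.inl (h.1.2 : 0 < x).ne')).div_const α).sub_const
        (c * (t ^ β / β))
    refine ((hf _ h.2).comp x h1).congr_deriv ?_
    simp only [G]
    field_simp
  have inv : ∀ {γ t : ℝ}, 0 < t → t ^ (1 - γ) * t ^ (γ - 1) = 1 := fun h => by
    rw [← Real.rpow_add h]
    simp
  refine ⟨_, fun q => f (z q), hD, ⟨⟨⟨ht, hx⟩, hzI⟩, ?_⟩, ⟨hu.mono inter_subset_left, ?_⟩, hf0,
    fun q hq => hq.1.1, fun q hq => hq.2, fun t x h => hdt t x h.1, fun t x h => hdx t x h.1⟩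
  · simpa [z, hf0] using hp
  · rintro t x ⟨h, -⟩
    have h1 : ∀ y, (t, y) ∈ D₁ → confDeriv α (fun y => f (z (t, y))) y = G (f (z (t, y))) :=
      fun y hy => by
        rw [confDeriv_eq_of_hasDerivAt (hdx t y hy)]
        linear_combination G (f (z (t, y))) * inv (γ := α) (hy.1.2 : 0 < y)
    have h2 : (fun y => confDeriv α (fun y => f (z (t, y))) y) =ᶠ[𝓝 x] fun y => G (f (z (t, y))) := by
      filter_upwards [eventually_mem_snd hD₁ h] with y hy using h1 y hy
    have h3 : HasDerivAt (fun y => G (f (z (t, y))))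
        ((c - a * f (z (t, x)) ^ 2) / b * (G (f (z (t, x))) * x ^ (α - 1))) x :=
      HasDerivAt.comp (h₂ := G) (h := fun y => f (z (t, y))) x
        (hasDerivAt_waveRate a b c p.2.2 P (f (z (t, x)))) (hdx t x h)
    rw [h1 x h, confDeriv_congr h2, confDeriv_eq_of_hasDerivAt h3,
      confDeriv_eq_of_hasDerivAt (hdt t x h)]
    have e1 := inv (γ := β) (h.1.1 : 0 < t)
    have e2 := inv (γ := α) (h.1.2 : 0 < x)
    generalize t ^ (1 - β) = A at *
    generalize t ^ (β - 1) = A' at *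
    generalize x ^ (1 - α) = B at *
    generalize x ^ (α - 1) = B' at *
    generalize G (f (z (t, x))) = g
    field_simp
    linear_combination -c * g * e1 + (c - a * f (z (t, x)) ^ 2) * g * e2

/-! ### One-parameter families of solutions and the linearized equation -/

section Slices

variable {S : Set (ℝ × ℝ × ℝ)} {U : ℝ × ℝ × ℝ → ℝ} (hS : IsOpen S) (hU : ContDiffOn ℝ ∞ U S)
  (ε : ℝ)
include hS

lemma isOpen_slice : IsOpen {q : ℝ × ℝ | (ε, q) ∈ S} :=
  hS.preimage (Continuous.prodMk_right ε)

include hU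

omit hS in
lemma contDiffOn_slice : ContDiffOn ℝ ∞ (fun q : ℝ × ℝ => U (ε, q)) {q : ℝ × ℝ | (ε, q) ∈ S} :=
  hU.comp (contDiffOn_const.prodMk contDiffOn_id) fun _ hq => hq

lemma pd_slice {q : ℝ × ℝ} (hq : (ε, q) ∈ S) (w : ℝ × ℝ) :
    pd w (fun q : ℝ × ℝ => U (ε, q)) q = pd (0, w) U (ε, q) := by
  have h := (differentiableAt_of_mem hS hU hq).hasFDerivAt.comp q
    ((hasFDerivAt_const ε q).prodMk (hasFDerivAt_id q))
  have h2 : fderiv ℝ (fun q : ℝ × ℝ => U (ε, q)) q = _ := h.fderiv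
  rw [pd, h2]
  simp [pd]

lemma pd_pd_slice {q : ℝ × ℝ} (hq : (ε, q) ∈ S) (v w : ℝ × ℝ) :
    pd w (pd v (fun q : ℝ × ℝ => U (ε, q))) q = pd (0, w) (pd (0, v) U) (ε, q) := by
  rw [pd_congr (g := fun q => pd (0, v) U (ε, q)) (isOpen_slice hS ε)
    (fun q hq => pd_slice hS hU ε hq v) hq, pd_slice hS (contDiffOn_pd hS hU _) ε hq]

end Slices

/-- The sequential conformable derivative in ordinary derivatives. -/
lemma confDeriv_confDeriv_snd {α : ℝ} {D : Set (ℝ × ℝ)} {u : ℝ × ℝ → ℝ} {t x : ℝ}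
    (hD : IsOpen D) (hu : ContDiffOn ℝ ∞ u D) (h : (t, x) ∈ D) (hx : 0 < x) :
    confDeriv α (fun y => confDeriv α (fun z => u (t, z)) y) x = (x ^ (1 - α)) ^ 2 *
      (pd (0, 1) (pd (0, 1) u) (t, x) + (1 - α) / x * pd (0, 1) u (t, x)) := by
  have h1 : (fun y => confDeriv α (fun z => u (t, z)) y) =ᶠ[𝓝 x]
      fun y => y ^ (1 - α) * pd (0, 1) u (t, y) := by
    filter_upwards [eventually_mem_snd hD h] with y hy
    exact confDeriv_eq_of_hasDerivAt (hasDerivAt_snd hD hu hy)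
  rw [confDeriv_congr h1, confDeriv_eq_of_hasDerivAt ((hasDerivAt_rpow_one_sub hx).fun_mul
      (hasDerivAt_snd hD (contDiffOn_pd hD hu (0, 1)) h))]
  ring

/-- The derivative of a one-parameter family of solutions solves the linearized equation. -/
lemma linearized_equation {α β a b : ℝ} {S : Set (ℝ × ℝ × ℝ)} {U : ℝ × ℝ × ℝ → ℝ}
    (hS : IsOpen S) (hU : ContDiffOn ℝ ∞ U S) (hx : ∀ z ∈ S, 0 < z.2.2)
    (hsol : ∀ ε, IsSolutionOn α β a b {q : ℝ × ℝ | (ε, q) ∈ S} fun q => U (ε, q))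
    {ε t x : ℝ} (h : (ε, t, x) ∈ S) :
    confDeriv β (fun s => pd (1, 0, 0) U (ε, s, x)) t
      + a * (2 * U (ε, t, x) * pd (1, 0, 0) U (ε, t, x) * confDeriv α (fun y => U (ε, t, y)) x
        + U (ε, t, x) ^ 2 * confDeriv α (fun y => pd (1, 0, 0) U (ε, t, y)) x)
      + b * confDeriv α (fun y => confDeriv α (fun z => pd (1, 0, 0) U (ε, t, z)) y) x = 0 := by
  have hQ := contDiffOn_pd hS hU (1, 0, 0)
  have hU2 := contDiffOn_pd hS hU (0, 1, 0)
  have hU3 := contDiffOn_pd hS hU (0, 0, 1)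
  have hU33 := contDiffOn_pd hS hU3 (0, 0, 1)
  have conv_t : ∀ {W : ℝ × ℝ × ℝ → ℝ}, ContDiffOn ℝ ∞ W S → ∀ {ε t x : ℝ}, (ε, t, x) ∈ S →
      confDeriv β (fun s => W (ε, s, x)) t = t ^ (1 - β) * pd (0, 1, 0) W (ε, t, x) :=
    fun hW ε t x h => by
      rw [← pd_slice hS hW ε h, ← confDeriv_eq_of_hasDerivAt
        (hasDerivAt_fst (isOpen_slice hS ε) (contDiffOn_slice hW ε) h)]
  have conv_x : ∀ {W : ℝ × ℝ × ℝ → ℝ}, ContDiffOn ℝ ∞ W S → ∀ {ε t x : ℝ}, (ε, t, x) ∈ S →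
      confDeriv α (fun s => W (ε, t, s)) x = x ^ (1 - α) * pd (0, 0, 1) W (ε, t, x) :=
    fun hW ε t x h => by
      rw [← pd_slice hS hW ε h, ← confDeriv_eq_of_hasDerivAt
        (hasDerivAt_snd (isOpen_slice hS ε) (contDiffOn_slice hW ε) h)]
  have conv_xx : ∀ {W : ℝ × ℝ × ℝ → ℝ}, ContDiffOn ℝ ∞ W S → ∀ {ε t x : ℝ}, (ε, t, x) ∈ S →
      confDeriv α (fun y => confDeriv α (fun z => W (ε, t, z)) y) x = (x ^ (1 - α)) ^ 2 *
        (pd (0, 0, 1) (pd (0, 0, 1) W) (ε, t, x) + (1 - α) / x * pd (0, 0, 1) W (ε, t, x)) :=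
    fun hW ε t x h => by
      rw [← pd_slice hS hW ε h, ← pd_pd_slice hS hW ε h, ← confDeriv_confDeriv_snd
        (isOpen_slice hS ε) (contDiffOn_slice hW ε) h (hx _ h)]
  rw [conv_t hQ h, conv_x hU h, conv_x hQ h, conv_xx hQ h]
  have eqn : ∀ z ∈ S, z.2.1 ^ (1 - β) * pd (0, 1, 0) U z
      + U z ^ 2 * (a * z.2.2 ^ (1 - α) * pd (0, 0, 1) U z)
      + b * (z.2.2 ^ (1 - α)) ^ 2 *
        (pd (0, 0, 1) (pd (0, 0, 1) U) z + (1 - α) / z.2.2 * pd (0, 0, 1) U z) = 0 := by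
    rintro ⟨ε, t, x⟩ hz
    have h1 := (hsol ε).2 t x hz
    rw [conv_t hU hz, conv_x hU hz, conv_xx hU hz] at h1
    linear_combination h1
  have hl : ∀ {W : ℝ × ℝ × ℝ → ℝ}, ContDiffOn ℝ ∞ W S →
      HasDerivAt (fun s : ℝ => W ((ε, t, x) + s • (1, 0, 0))) (pd (1, 0, 0) W (ε, t, x)) 0 :=
    fun hW => hasDerivAt_line hS hW h (1, 0, 0)
  -- Moving in the ε direction fixes t and x, so the weights are constants in this differentiation.
  have e1 : ∀ s : ℝ, ((ε, t, x) + s • ((1, 0, 0) : ℝ × ℝ × ℝ)).2.1 = t := by simp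
  have e2 : ∀ s : ℝ, ((ε, t, x) + s • ((1, 0, 0) : ℝ × ℝ × ℝ)).2.2 = x := by simp
  have key := deriv_line_eq_zero hS eqn h (1, 0, 0) (by
    simp only [e1, e2]
    exact (((hl hU2).const_mul (t ^ (1 - β))).fun_add (((hl hU).fun_pow 2).fun_mul
      ((hl hU3).const_mul (a * x ^ (1 - α))))).fun_add
      (((hl hU33).fun_add ((hl hU3).const_mul ((1 - α) / x))).const_mul (b * (x ^ (1 - α)) ^ 2)))
  have c1 := pd_comm hS hU h (1, 0, 0) (0, 1, 0)
  have c2 : ∀ z ∈ S, pd (1, 0, 0) (pd (0, 0, 1) U) z = pd (0, 0, 1) (pd (1, 0, 0) U) z :=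
    fun z hz => pd_comm hS hU hz _ _
  have c3 : pd (1, 0, 0) (pd (0, 0, 1) (pd (0, 0, 1) U)) (ε, t, x)
      = pd (0, 0, 1) (pd (0, 0, 1) (pd (1, 0, 0) U)) (ε, t, x) := by
    rw [pd_comm hS hU3 h, pd_congr hS c2 h]
  rw [c1, c2 _ h, c3] at key
  simp at key
  linear_combination key

/-- The inverse function theorem, with a smooth inverse on an open set. -/
lemma exists_smooth_localInverse {E : Type*} [NormedAddCommGroup E] [NormedSpace ℝ E]
    [CompleteSpace E] {F : E → E} {W : Set E} (hW : IsOpen W) (hF : ContDiffOn ℝ ∞ F W) {x : E}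
    (hx : x ∈ W) (L : E ≃L[ℝ] E) (hL : fderiv ℝ F x = L) :
    ∃ e : OpenPartialHomeomorph E E, x ∈ e.source ∧ e.source ⊆ W ∧ ⇑e = F ∧
      ContDiffOn ℝ ∞ e.symm e.target := by
  have hd : ∀ y ∈ W, HasFDerivAt F (fderiv ℝ F y) y := fun y hy =>
    (differentiableAt_of_mem hW hF hy).hasFDerivAt
  -- Invertible operators form an open set. Restricting to points with invertible derivative makes
  -- the inverse smooth on the whole target.
  have hW' : IsOpen (W ∩ fderiv ℝ F ⁻¹' range ((↑) : (E ≃L[ℝ] E) → E →L[ℝ] E)) :=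
    (hF.continuousOn_fderiv_of_isOpen hW (by simp)).isOpen_inter_preimage hW
      ContinuousLinearEquiv.isOpen
  have hc := contDiffAt_of_mem hW hF hx
  have hd' : HasFDerivAt F (L : E →L[ℝ] E) x := hL ▸ hd x hx
  let e := (hc.toOpenPartialHomeomorph F hd' (by simp)).restrOpen _ hW'
  have hes : e.source = _ := OpenPartialHomeomorph.restrOpen_source _ _ hW'
  refine ⟨e, ?_, ?_, rfl, fun y hy => ContDiffAt.contDiffWithinAt ?_⟩
  · rw [hes]
    exact ⟨hc.mem_toOpenPartialHomeomorph_source hd' (by simp), hx, L, hL.symm⟩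
  · rw [hes]
    exact fun y hy => hy.2.1
  · have hm := e.map_target hy
    rw [hes] at hm
    obtain ⟨-, hm, L', hL'⟩ := hm
    exact e.contDiffAt_symm hy (f₀' := L') (hL' ▸ hd _ hm) (contDiffAt_of_mem hW hF hm)

/-- The shear `(s, y) ↦ (s, y + s w)`. -/
noncomputable def shear (w : ℝ × ℝ) : (ℝ × ℝ × ℝ) ≃L[ℝ] (ℝ × ℝ × ℝ) :=
  ContinuousLinearEquiv.equivOfInverse
    ((ContinuousLinearMap.fst ℝ ℝ (ℝ × ℝ)).prod (ContinuousLinearMap.snd ℝ ℝ (ℝ × ℝ)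
      + (ContinuousLinearMap.fst ℝ ℝ (ℝ × ℝ)).smulRight w))
    ((ContinuousLinearMap.fst ℝ ℝ (ℝ × ℝ)).prod (ContinuousLinearMap.snd ℝ ℝ (ℝ × ℝ)
      - (ContinuousLinearMap.fst ℝ ℝ (ℝ × ℝ)).smulRight w))
    (fun z => by simp) (fun z => by simp)

lemma shear_apply (w : ℝ × ℝ) (z : ℝ × ℝ × ℝ) : shear w z = (z.1, z.2 + z.1 • w) := rfl

/-! ### The deformation of a solution by a local one-parameter group -/

/-- The deformation of a solution `u` by a local one-parameter group of symmetries is, near each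
point, a smooth one-parameter family of solutions; its derivative at `0` is the characteristic
of the vector field. -/
lemma exists_deformation {α β a b δ : ℝ} (hδ : 0 < δ) {N : Set (ℝ × ℝ × ℝ)}
    {V : ℝ × ℝ × ℝ → ℝ × ℝ × ℝ} {Φ : ℝ → ℝ × ℝ × ℝ → ℝ × ℝ × ℝ}
    (hΦ : ContDiffOn ℝ ∞ (fun z : ℝ × ℝ × ℝ × ℝ => Φ z.1 z.2) (Ioo (-δ) δ ×ˢ N))
    (hΦ0 : ∀ q ∈ N, Φ 0 q = q) (hΦV : ∀ q ∈ N, HasDerivAt (fun s => Φ s q) (V q) 0)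
    (hsol : ∀ ε ∈ Ioo (-δ) δ, MapsSolutions α β a b N (Φ ε))
    {D : Set (ℝ × ℝ)} {u : ℝ × ℝ → ℝ} (hD : IsOpen D) (hu : IsSolutionOn α β a b D u)
    (hDN : ∀ q ∈ D, (q.1, q.2, u q) ∈ N) {q₀ : ℝ × ℝ} (hq₀ : q₀ ∈ D) :
    ∃ (S : Set (ℝ × ℝ × ℝ)) (U : ℝ × ℝ × ℝ → ℝ), IsOpen S ∧ (0, q₀) ∈ S ∧ ContDiffOn ℝ ∞ U S ∧
      (∀ ε, IsSolutionOn α β a b {q : ℝ × ℝ | (ε, q) ∈ S} fun q => U (ε, q)) ∧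
      ∀ q, (0, q) ∈ S → q ∈ D ∧ U (0, q) = u q ∧ pd (1, 0, 0) U (0, q) =
        (V (q.1, q.2, u q)).2.2 - (V (q.1, q.2, u q)).1 * pd (1, 0) u q
          - (V (q.1, q.2, u q)).2.1 * pd (0, 1) u q := by
  let Ψ : ℝ × ℝ × ℝ → ℝ × ℝ × ℝ := fun z => Φ z.1 (z.2.1, z.2.2, u z.2)
  let F : ℝ × ℝ × ℝ → ℝ × ℝ × ℝ := fun z => (z.1, (Ψ z).1, (Ψ z).2.1)
  have h0 : (0 : ℝ) ∈ Ioo (-δ) δ := by simp [hδ]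
  have hW : IsOpen (Ioo (-δ) δ ×ˢ D) := isOpen_Ioo.prod hD
  have hΨ : ContDiffOn ℝ ∞ Ψ (Ioo (-δ) δ ×ˢ D) := by
    have h1 : ContDiffOn ℝ ∞ (fun z : ℝ × ℝ × ℝ => u z.2) (Ioo (-δ) δ ×ˢ D) :=
      hu.1.comp contDiffOn_snd fun z hz => hz.2
    exact hΦ.comp (f := fun z : ℝ × ℝ × ℝ => (z.1, z.2.1, z.2.2, u z.2))
      (contDiffOn_fst.prodMk (contDiffOn_snd.fst.prodMk (contDiffOn_snd.snd.prodMk h1)))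
      fun z hz => ⟨hz.1, hDN _ hz.2⟩
  have hF : ContDiffOn ℝ ∞ F (Ioo (-δ) δ ×ˢ D) :=
    contDiffOn_fst.prodMk (hΨ.fst.prodMk hΨ.snd.fst)
  have hΨ0 : ∀ q ∈ D, Ψ (0, q) = (q.1, q.2, u q) := fun q hq => hΦ0 _ (hDN q hq)
  have hF0 : ∀ q ∈ D, F (0, q) = (0, q) := fun q hq => by simp [F, hΨ0 q hq]
  have hFd : ∀ q ∈ D, HasDerivAt (fun s => F (s, q))
      (1, (V (q.1, q.2, u q)).1, (V (q.1, q.2, u q)).2.1) 0 := fun q hq =>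
    (hasDerivAt_id (0 : ℝ)).prodMk ((hΦV _ (hDN q hq)).fst.prodMk (hΦV _ (hDN q hq)).snd.fst)
  -- As F(0, ·) is the identity, the derivative fixes the (t, x) directions and sends the ε
  -- direction to (1, τ, ξ). This is a shear, hence invertible.
  have hFL : fderiv ℝ F (0, q₀) =
      shear ((V (q₀.1, q₀.2, u q₀)).1, (V (q₀.1, q₀.2, u q₀)).2.1) := by
    have hd := (differentiableAt_of_mem hW hF (mk_mem_prod h0 hq₀)).hasFDerivAt
    have h1 : fderiv ℝ F (0, q₀) (1, 0) =
        (1, (V (q₀.1, q₀.2, u q₀)).1, (V (q₀.1, q₀.2, u q₀)).2.1) :=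
      (hd.comp_hasDerivAt (f := fun s : ℝ => (s, q₀)) (0 : ℝ)
        ((hasDerivAt_id (0 : ℝ)).prodMk (hasDerivAt_const 0 q₀))).unique (hFd q₀ hq₀)
    have h2 : ∀ v : ℝ × ℝ, fderiv ℝ F (0, q₀) (0, v) = (0, v) := fun v => by
      have k1 := hd.comp q₀ ((hasFDerivAt_const (0 : ℝ) q₀).prodMk (hasFDerivAt_id q₀))
      have k2 : (F ∘ fun q => (0, q)) =ᶠ[𝓝 q₀] fun q => ((0 : ℝ), q) := by
        filter_upwards [hD.mem_nhds hq₀] with q hq using hF0 q hq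
      have k3 := (((hasFDerivAt_const (0 : ℝ) q₀).prodMk
        (hasFDerivAt_id q₀)).congr_of_eventuallyEq k2).unique k1
      simpa using (DFunLike.congr_fun k3 v).symm
    refine ContinuousLinearMap.ext fun z => ?_
    have hz : z = z.1 • (1, 0) + (0, z.2) := by simp
    conv_lhs => rw [hz]
    rw [map_add, map_smul, h1, h2]
    ext <;> simp [shear_apply, add_comm]
  obtain ⟨e, he0, heW, heF, hes⟩ := exists_smooth_localInverse hW hF (mk_mem_prod h0 hq₀) _ hFL
  have hsymm : ∀ y ∈ e.target, e.symm y ∈ e.source ∧ F (e.symm y) = y := fun y hy =>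
    ⟨e.map_target hy, by rw [← heF, e.right_inv hy]⟩
  have hfst : ∀ y ∈ e.target, (e.symm y).1 = y.1 := fun y hy => by
    have h := congrArg Prod.fst (hsymm y hy).2
    exact h
  have hmap : ∀ z ∈ e.source, F z ∈ e.target ∧ e.symm (F z) = z := fun z hz =>
    ⟨by rw [← heF]; exact e.map_source hz, by rw [← heF]; exact e.left_inv hz⟩
  let U : ℝ × ℝ × ℝ → ℝ := fun y => (Ψ (e.symm y)).2.2
  have hU : ContDiffOn ℝ ∞ U e.target :=
    ContDiffOn.comp (g := fun z => (Ψ z).2.2) hΨ.snd.snd hes fun y hy => heW (hsymm y hy).1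
  have hzero : ∀ q, (0, q) ∈ e.target → (0, q) ∈ e.source ∧ e.symm (0, q) = (0, q) := by
    intro q hq
    obtain ⟨h1, h2⟩ := hsymm _ hq
    have h3 : e.symm (0, q) = (0, (e.symm (0, q)).2) := Prod.ext (hfst _ hq) rfl
    have h4 := heW h1
    rw [h3] at h2 h4
    rw [hF0 _ h4.2] at h2
    rw [h2] at h3
    exact ⟨h3 ▸ h1, h3⟩
  refine ⟨e.target, U, e.open_target, ?_, hU, fun ε => ?_, fun q hq => ?_⟩
  · rw [← hF0 q₀ hq₀]
    exact (hmap _ he0).1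
  -- For ε outside (-δ, δ) the slice is empty and there is nothing to prove.
  · rcases eq_empty_or_nonempty {q : ℝ × ℝ | (ε, q) ∈ e.target} with hemp | ⟨q₁, hq₁⟩
    · rw [hemp]
      exact ⟨contDiffOn_empty, fun t x h => h.elim⟩
    have hε : ε ∈ Ioo (-δ) δ := by
      have := (heW (hsymm _ hq₁).1).1
      rwa [hfst _ hq₁] at this
    have hDs : {q : ℝ × ℝ | (ε, q) ∈ e.source} ⊆ D := fun q hq => (heW hq).2
    -- The transformation Φ ε carries the graph of u over the source slice onto the graph of U(ε, ·)
    -- over the target slice.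
    refine hsol ε hε {q | (ε, q) ∈ e.source} u _ _ (isOpen_slice e.open_source ε)
      ⟨hu.1.mono hDs, fun t x h => hu.2 t x (hDs h)⟩ ?_ (isOpen_slice e.open_target ε)
      (contDiffOn_slice hU ε) (Subset.antisymm ?_ ?_)
    · rintro _ ⟨q, hq, rfl⟩
      exact hDN q (hDs hq)
    · rintro _ ⟨q, hq, rfl⟩
      obtain ⟨h1, h2⟩ := hsymm _ hq
      have h3 : e.symm (ε, q) = (ε, (e.symm (ε, q)).2) := Prod.ext (hfst _ hq) rfl
      refine ⟨_, ⟨(e.symm (ε, q)).2, by rw [mem_ofPred_eq, ← h3]; exact h1, rfl⟩, ?_⟩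
      have h4 : Φ ε ((e.symm (ε, q)).2.1, (e.symm (ε, q)).2.2, u (e.symm (ε, q)).2)
          = Ψ (e.symm (ε, q)) := by
        simp only [Ψ, hfst _ hq]
      have h5 := congrArg Prod.snd h2
      simp only [F] at h5
      rw [h4]
      have h6 := congrArg Prod.fst h5
      have h7 := congrArg Prod.snd h5
      exact Prod.ext h6 (Prod.ext h7 rfl)
    · rintro _ ⟨_, ⟨q, hq, rfl⟩, rfl⟩
      obtain ⟨h1, h2⟩ := hmap _ hq
      refine ⟨((Ψ (ε, q)).1, (Ψ (ε, q)).2.1), h1, ?_⟩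
      have h3 : U (ε, (Ψ (ε, q)).1, (Ψ (ε, q)).2.1) = (Ψ (ε, q)).2.2 := by
        change (Ψ (e.symm (F (ε, q)))).2.2 = _
        rw [h2]
      simp only [h3]
      rfl
  · have hU0 : ∀ q, (0, q) ∈ e.target → U (0, q) = u q := fun q hq => by
      obtain ⟨h1, h2⟩ := hzero q hq
      simp only [U, h2, hΨ0 q (heW h1).2]
    obtain ⟨hqs, -⟩ := hzero q hq
    have hqD : q ∈ D := (heW hqs).2
    refine ⟨hqD, hU0 q hq, ?_⟩
    have hslice : ∀ w, pd (0, w) U (0, q) = pd w u q := fun w => by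
      rw [← pd_slice e.open_target hU 0 hq]
      exact pd_congr (isOpen_slice e.open_target 0) (fun q hq => hU0 q hq) hq w
    have h1 : HasDerivAt (fun s => U (F (s, q))) (fderiv ℝ U (0, q)
        (1, (V (q.1, q.2, u q)).1, (V (q.1, q.2, u q)).2.1)) 0 := by
      have h2 : HasFDerivAt U (fderiv ℝ U (0, q)) (F (0, q)) := by
        rw [hF0 q hqD]
        exact (differentiableAt_of_mem e.open_target hU hq).hasFDerivAt
      exact h2.comp_hasDerivAt (0 : ℝ) (hFd q hqD)
    have h3 : (fun s => U (F (s, q))) =ᶠ[𝓝 0] fun s => (Ψ (s, q)).2.2 := by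
      have : ∀ᶠ s in 𝓝 (0 : ℝ), (s, q) ∈ e.source :=
        (Continuous.prodMk_left q).continuousAt.preimage_mem_nhds (e.open_source.mem_nhds hqs)
      filter_upwards [this] with s hs
      simp only [U, (hmap _ hs).2]
    have hΨd : HasDerivAt (fun s => (Ψ (s, q)).2.2) (V (q.1, q.2, u q)).2.2 0 :=
      (hΦV _ (hDN q hqD)).snd.snd
    -- Differentiating U(F(s, q)) = (Ψ(s, q)).2.2 at s = 0 gives U_ε + τ U_t + ξ U_x = η.
    have h4 := h1.unique (hΨd.congr_of_eventuallyEq h3)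
    rw [fderiv_triple] at h4
    have h5 := hslice (1, 0)
    have h6 := hslice (0, 1)
    rw [← h5, ← h6]
    linear_combination h4

/-! ### The characteristic along travelling waves -/

/-- The characteristic `η - τ u_t - ξ u_x` along travelling waves of velocity `c`, where
`τ = t^(1-β) T`, `ξ = x^(1-α) X`, `t^(1-β) u_t = -c G`, `x^(1-α) u_x = G`. -/
def waveCharacteristic (G : ℝ → ℝ) (c : ℝ) (T X η : ℝ × ℝ × ℝ → ℝ) (p : ℝ × ℝ × ℝ) : ℝ :=
  η p - (X p - c * T p) * G p.2.2

lemma hasFDerivAt_snd_snd (p : ℝ × ℝ × ℝ) : HasFDerivAt (fun q : ℝ × ℝ × ℝ => q.2.2)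
    ((ContinuousLinearMap.snd ℝ ℝ ℝ).comp (ContinuousLinearMap.snd ℝ ℝ (ℝ × ℝ))) p :=
  ((ContinuousLinearMap.snd ℝ ℝ ℝ).comp (ContinuousLinearMap.snd ℝ ℝ (ℝ × ℝ))).hasFDerivAt

lemma hasFDerivAt_waveRate (a b c u₀ P : ℝ) (p : ℝ × ℝ × ℝ) :
    HasFDerivAt (fun q : ℝ × ℝ × ℝ => waveRate a b c u₀ P q.2.2) (((c - a * p.2.2 ^ 2) / b) •
      ((ContinuousLinearMap.snd ℝ ℝ ℝ).comp (ContinuousLinearMap.snd ℝ ℝ (ℝ × ℝ)))) p :=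
  HasDerivAt.comp_hasFDerivAt (h₂ := waveRate a b c u₀ P) (f := fun q : ℝ × ℝ × ℝ => q.2.2) p
    (hasDerivAt_waveRate a b c u₀ P p.2.2) (hasFDerivAt_snd_snd p)

section Characteristic

variable {α β a b c u₀ P : ℝ} {Ω : Set (ℝ × ℝ × ℝ)} {T X η : ℝ × ℝ × ℝ → ℝ}
  (hT : ContDiffOn ℝ ∞ T Ω) (hX : ContDiffOn ℝ ∞ X Ω) (hη : ContDiffOn ℝ ∞ η Ω)
include hT hX hη

lemma contDiffOn_waveCharacteristic :
    ContDiffOn ℝ ∞ (waveCharacteristic (waveRate a b c u₀ P) c T X η) Ω := by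
  have h : ContDiffOn ℝ ∞ (fun p : ℝ × ℝ × ℝ => waveRate a b c u₀ P p.2.2) Ω :=
    ((contDiff_waveRate a b c u₀ P).comp (contDiff_snd.comp contDiff_snd)).contDiffOn
  exact hη.sub ((hX.sub (contDiffOn_const.mul hT)).mul h)

variable (hΩo : IsOpen Ω) {p : ℝ × ℝ × ℝ} (hp : p ∈ Ω)
include hΩo hp

/-- The factor G depends on u alone, so the extra term with G' = (c - a u²)/b appears only for
directions with a u-component. -/
lemma pd_waveCharacteristic (v : ℝ × ℝ × ℝ) :
    pd v (waveCharacteristic (waveRate a b c u₀ P) c T X η) p =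
      waveCharacteristic (waveRate a b c u₀ P) c (pd v T) (pd v X) (pd v η) p
        - (X p - c * T p) * ((c - a * p.2.2 ^ 2) / b * v.2.2) := by
  have h : HasFDerivAt (waveCharacteristic (waveRate a b c u₀ P) c T X η) _ p :=
    (differentiableAt_of_mem hΩo hη hp).hasFDerivAt.sub
      (((differentiableAt_of_mem hΩo hX hp).hasFDerivAt.sub
        ((differentiableAt_of_mem hΩo hT hp).hasFDerivAt.const_mul c)).mul
        (hasFDerivAt_waveRate a b c u₀ P p))
  rw [pd, h.fderiv]
  simp [pd, waveCharacteristic]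
  ring

lemma dS_waveCharacteristic :
    dS β (waveCharacteristic (waveRate a b c u₀ P) c T X η) p =
      waveCharacteristic (waveRate a b c u₀ P) c (dS β T) (dS β X) (dS β η) p := by
  rw [dS, pd_waveCharacteristic hT hX hη hΩo hp]
  simp only [waveCharacteristic, dS]
  ring

lemma dY_waveCharacteristic :
    dY α (waveCharacteristic (waveRate a b c u₀ P) c T X η) p =
      waveCharacteristic (waveRate a b c u₀ P) c (dY α T) (dY α X) (dY α η) p := by
  rw [dY, pd_waveCharacteristic hT hX hη hΩo hp]
  simp only [waveCharacteristic, dY]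
  ring

lemma dU_waveCharacteristic :
    dU (waveCharacteristic (waveRate a b c u₀ P) c T X η) p =
      waveCharacteristic (waveRate a b c u₀ P) c (dU T) (dU X) (dU η) p
        - (X p - c * T p) * ((c - a * p.2.2 ^ 2) / b) := by
  rw [dU, pd_waveCharacteristic hT hX hη hΩo hp, mul_one]
  simp only [waveCharacteristic, dU]

/-- The linearized equation for the characteristic is the prolongation condition. -/
lemma linearized_waveCharacteristic (hb : b ≠ 0) (hΩ : ∀ p ∈ Ω, 0 < p.1 ∧ 0 < p.2.1)
    {G : ℝ → ℝ} (hG : G = waveRate a b c u₀ P) {E : ℝ × ℝ × ℝ → ℝ}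
    (hE : E = waveCharacteristic G c T X η) :
    dS β E p - c * G p.2.2 * dU E p + a * (2 * p.2.2 * E p * G p.2.2
        + p.2.2 ^ 2 * (dY α E p + G p.2.2 * dU E p))
      + b * (dY α (fun q => dY α E q + G q.2.2 * dU E q) p
        + G p.2.2 * dU (fun q => dY α E q + G q.2.2 * dU E q) p) =
    weightedProlongation α β a b T X η p (-c * G p.2.2) (G p.2.2)
      (-c * (G p.2.2 * (c - a * p.2.2 ^ 2) / b)) (G p.2.2 * (c - a * p.2.2 ^ 2) / b) := by
  subst hG hE
  set G := waveRate a b c u₀ P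
  set E := waveCharacteristic G c T X η with hEd
  have sE : ContDiffOn ℝ ∞ E Ω := contDiffOn_waveCharacteristic hT hX hη
  have sTy := contDiffOn_dY (α := α) hΩo hΩ hT
  have sXy := contDiffOn_dY (α := α) hΩo hΩ hX
  have sηy := contDiffOn_dY (α := α) hΩo hΩ hη
  have sEy := contDiffOn_dY (α := α) hΩo hΩ sE
  have sTu : ContDiffOn ℝ ∞ (dU T) Ω := contDiffOn_pd hΩo hT _
  have sXu : ContDiffOn ℝ ∞ (dU X) Ω := contDiffOn_pd hΩo hX _
  have sηu : ContDiffOn ℝ ∞ (dU η) Ω := contDiffOn_pd hΩo hη _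
  have sEu : ContDiffOn ℝ ∞ (dU E) Ω := contDiffOn_pd hΩo sE _
  have step : ∀ v : ℝ × ℝ × ℝ, pd v (fun q => dY α E q + G q.2.2 * dU E q) p =
      pd v (dY α E) p + ((c - a * p.2.2 ^ 2) / b * v.2.2 * dU E p + G p.2.2 * pd v (dU E) p) := by
    intro v
    have d1 := differentiableAt_of_mem hΩo sEu hp
    have h2 : HasFDerivAt (fun q : ℝ × ℝ × ℝ => dY α E q + G q.2.2 * dU E q) _ p :=
      (differentiableAt_of_mem hΩo sEy hp).hasFDerivAt.add
        ((hasFDerivAt_waveRate a b c u₀ P p).mul d1.hasFDerivAt)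
    rw [pd, h2.fderiv]
    simp [pd, G]
    ring
  have y1 : ∀ q ∈ Ω, dY α E q = waveCharacteristic G c (dY α T) (dY α X) (dY α η) q :=
    fun q hq => dY_waveCharacteristic hT hX hη hΩo hq
  have yy : dY α (dY α E) p = waveCharacteristic G c (dY α (dY α T)) (dY α (dY α X))
      (dY α (dY α η)) p := by
    rw [← dY_waveCharacteristic sTy sXy sηy hΩo hp, dY, pd_congr hΩo y1 hp, dY]
  have uy : dU (dY α E) p = waveCharacteristic G c (dU (dY α T)) (dU (dY α X)) (dU (dY α η)) p
      - (dY α X p - c * dY α T p) * ((c - a * p.2.2 ^ 2) / b) := by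
    rw [← dU_waveCharacteristic sTy sXy sηy hΩo hp, dU, pd_congr hΩo y1 hp, dU]
  have hs : dS β E p = _ := dS_waveCharacteristic hT hX hη hΩo hp
  have hu : ∀ q ∈ Ω, dU E q = waveCharacteristic G c (dU T) (dU X) (dU η) q
      - (X q - c * T q) * ((c - a * q.2.2 ^ 2) / b) :=
    fun q hq => dU_waveCharacteristic hT hX hη hΩo hq
  have uu : dU (dU E) p = waveCharacteristic G c (dU (dU T)) (dU (dU X)) (dU (dU η)) p
      - 2 * (dU X p - c * dU T p) * ((c - a * p.2.2 ^ 2) / b)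
      + (X p - c * T p) * (2 * a * p.2.2 / b) := by
    have h1 := dU_waveCharacteristic (a := a) (b := b) (c := c) (u₀ := u₀) (P := P) sTu sXu sηu
      hΩo hp
    have h2 : HasFDerivAt (fun q : ℝ × ℝ × ℝ => waveCharacteristic G c (dU T) (dU X) (dU η) q
      - (X q - c * T q) * ((c - a * q.2.2 ^ 2) / b)) _ p :=
      (differentiableAt_of_mem hΩo (contDiffOn_waveCharacteristic sTu sXu sηu) hp).hasFDerivAt.sub
        (((differentiableAt_of_mem hΩo hX hp).hasFDerivAt.sub
          ((differentiableAt_of_mem hΩo hT hp).hasFDerivAt.const_mul c)).mul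
          (((((hasFDerivAt_snd_snd p).pow 2).const_mul a).const_sub c).mul_const b⁻¹))
    rw [dU, pd_congr hΩo hu hp, pd]
    simp only [div_eq_mul_inv] at h2 ⊢
    rw [h2.fderiv]
    have h3 : fderiv ℝ (waveCharacteristic (waveRate a b c u₀ P) c (dU T) (dU X) (dU η)) p
      (0, 0, 1) = _ := h1
    simp [h3]
    simp only [dU, pd, G]
    ring
  have stepY : dY α (fun q => dY α E q + G q.2.2 * dU E q) p
      = dY α (dY α E) p + G p.2.2 * dU (dY α E) p := by
    rw [dU_dY hΩo hΩ sE hp, dY, step]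
    simp only [dY]
    ring
  have stepU : dU (fun q => dY α E q + G q.2.2 * dU E q) p
      = dU (dY α E) p + ((c - a * p.2.2 ^ 2) / b * dU E p + G p.2.2 * dU (dU E) p) := by
    rw [dU, step, mul_one]
    simp only [dU]
  rw [stepY, stepU, yy, uy, uu, hs, hu p hp, y1 p hp, hEd, weightedProlongation]
  simp only [waveCharacteristic]
  field_simp
  ring

end Characteristic

/-! ### Symmetries satisfy the determining equations -/

section AlongGraph

variable {α β k : ℝ} {Ω : Set (ℝ × ℝ × ℝ)} {f : ℝ × ℝ × ℝ → ℝ} {u : ℝ × ℝ → ℝ} {t x : ℝ}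
  (hΩo : IsOpen Ω) (hf : ContDiffOn ℝ ∞ f Ω) (hp : (t, x, u (t, x)) ∈ Ω)
include hΩo hf hp

/-- Chain rule on the graph of u: the conformable derivative acts as ∂_s + u_s ∂_u, with k = u_s. -/
lemma confDeriv_graph_fst (ht : 0 < t)
    (hu : HasDerivAt (fun s => u (s, x)) (k * t ^ (β - 1)) t) :
    confDeriv β (fun s => f (s, x, u (s, x))) t =
      dS β f (t, x, u (t, x)) + k * dU f (t, x, u (t, x)) := by
  have h := HasFDerivAt.comp_hasDerivAt (f := fun s => (s, x, u (s, x))) t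
    (differentiableAt_of_mem hΩo hf hp).hasFDerivAt
    ((hasDerivAt_id t).prodMk ((hasDerivAt_const t x).prodMk hu))
  have h' : HasDerivAt (fun s => f (s, x, u (s, x))) _ t := h
  have e : t ^ (1 - β) * t ^ (β - 1) = 1 := by
    rw [← Real.rpow_add ht]
    simp
  rw [confDeriv_eq_of_hasDerivAt h', fderiv_triple, dS, dU]
  linear_combination k * pd (0, 0, 1) f (t, x, u (t, x)) * e

lemma confDeriv_graph_snd (hx : 0 < x)
    (hu : HasDerivAt (fun y => u (t, y)) (k * x ^ (α - 1)) x) :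
    confDeriv α (fun y => f (t, y, u (t, y))) x =
      dY α f (t, x, u (t, x)) + k * dU f (t, x, u (t, x)) := by
  have h := HasFDerivAt.comp_hasDerivAt (f := fun y => (t, y, u (t, y))) x
    (differentiableAt_of_mem hΩo hf hp).hasFDerivAt
    ((hasDerivAt_const x t).prodMk ((hasDerivAt_id x).prodMk hu))
  have h' : HasDerivAt (fun y => f (t, y, u (t, y))) _ x := h
  have e : x ^ (1 - α) * x ^ (α - 1) = 1 := by
    rw [← Real.rpow_add hx]
    simp
  rw [confDeriv_eq_of_hasDerivAt h', fderiv_triple, dY, dU]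
  linear_combination k * pd (0, 0, 1) f (t, x, u (t, x)) * e

end AlongGraph

lemma IsSolutionOn.mono {α β a b : ℝ} {D D' : Set (ℝ × ℝ)} {u : ℝ × ℝ → ℝ}
    (h : IsSolutionOn α β a b D u) (hD : D' ⊆ D) : IsSolutionOn α β a b D' u :=
  ⟨h.1.mono hD, fun t x hx => h.2 t x (hD hx)⟩

/-- At a given point, with given c and P, the wave through that point is deformed by the local
group. Its ε-derivative is the characteristic, and the linearized equation at the point is the
required identity. -/
lemma GeneratesSymmetries.vanishesOnWaves {α β a b : ℝ} (hα : 0 < α) (hβ : 0 < β) (hb : b ≠ 0)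
    {Ω : Set (ℝ × ℝ × ℝ)} (hΩo : IsOpen Ω) (hΩ : ∀ p ∈ Ω, 0 < p.1 ∧ 0 < p.2.1)
    {V : ℝ × ℝ × ℝ → ℝ × ℝ × ℝ} (h : GeneratesSymmetries α β a b Ω V) :
    VanishesOnWaves α β a b Ω (fun q => q.1 ^ (β - 1) * (V q).1)
      (fun q => q.2.1 ^ (α - 1) * (V q).2.1) (fun q => (V q).2.2) := by
  intro p hp c P
  obtain ⟨hV, h⟩ := h
  obtain ⟨δ, hδ, N, hN, hpN, hNΩ, Φ, hΦ, hΦ0, hΦV, hsol⟩ := h p hp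
  obtain ⟨ht, hx⟩ := hΩ p hp
  have hΦV0 : ∀ q ∈ N, HasDerivAt (fun s => Φ s q) (V q) 0 := fun q hq => by
    have h1 := (hΦV 0 (by simp [hδ]) q hq).2
    rwa [hΦ0 q hq] at h1
  obtain ⟨D, u, hD, hpD, hu, hup, hDpos, hDN, hut, hux⟩ :=
    exists_wave α β a b hb hα hβ ht hx c P hN hpN
  obtain ⟨S₀, U, hS₀, hpS₀, hU₀, hUsol₀, hU0⟩ :=
    exists_deformation hδ hΦ hΦ0 hΦV0 hsol hD hu hDN hpD
  -- Positivity of x is known only on the slice ε = 0; the intersection provides it for every ε, as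
  -- the linearized equation requires.
  set S := S₀ ∩ {z | 0 < z.2.2} with hSd
  have hS : IsOpen S := hS₀.inter (isOpen_lt continuous_const (by fun_prop))
  have hpS : ((0 : ℝ), p.1, p.2.1) ∈ S := ⟨hpS₀, hx⟩
  have hU : ContDiffOn ℝ ∞ U S := hU₀.mono inter_subset_left
  have lin := linearized_equation (α := α) (β := β) (a := a) (b := b) hS hU (fun z hz => hz.2)
    (fun ε => (hUsol₀ ε).mono fun q hq => hq.1) hpS
  set T : ℝ × ℝ × ℝ → ℝ := fun q => q.1 ^ (β - 1) * (V q).1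
  set X : ℝ × ℝ × ℝ → ℝ := fun q => q.2.1 ^ (α - 1) * (V q).2.1
  set η : ℝ × ℝ × ℝ → ℝ := fun q => (V q).2.2
  have sT : ContDiffOn ℝ ∞ T Ω := contDiffOn_weight_fst hΩ hV.fst
  have sX : ContDiffOn ℝ ∞ X Ω := contDiffOn_weight_snd hΩ hV.snd.fst
  have sη : ContDiffOn ℝ ∞ η Ω := hV.snd.snd
  set G := waveRate a b c p.2.2 P with hG
  set E := waveCharacteristic G c T X η with hE
  have sE : ContDiffOn ℝ ∞ E Ω := contDiffOn_waveCharacteristic sT sX sη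
  have hD' : ∀ {q : ℝ × ℝ}, (0, q) ∈ S → q ∈ D := fun hq => (hU0 _ hq.1).1
  have hΩ' : ∀ {q : ℝ × ℝ}, (0, q) ∈ S → (q.1, q.2, u q) ∈ Ω := fun hq => hNΩ (hDN _ (hD' hq))
  have hQ : ∀ {t x : ℝ}, ((0 : ℝ), t, x) ∈ S →
      pd (1, 0, 0) U (0, t, x) = E (t, x, u (t, x)) := by
    intro t x hq
    have h1 := (hU0 _ hq.1).2.2
    rw [(hasDerivAt_fst hD hu.1 (hD' hq)).unique (hut _ _ (hD' hq)),
      (hasDerivAt_snd hD hu.1 (hD' hq)).unique (hux _ _ (hD' hq))] at h1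
    rw [h1]
    simp only [E, waveCharacteristic, T, X, η, G]
    ring
  have hs : IsOpen {q : ℝ × ℝ | ((0 : ℝ), q) ∈ S} := isOpen_slice hS 0
  have pos : ∀ {t x : ℝ}, ((0 : ℝ), t, x) ∈ S → 0 < t ∧ 0 < x := fun hq => hDpos _ (hD' hq)
  have e1 : confDeriv β (fun s => pd (1, 0, 0) U (0, s, p.2.1)) p.1 =
      dS β E p - c * G p.2.2 * dU E p := by
    have h1 : (fun s => pd (1, 0, 0) U (0, s, p.2.1)) =ᶠ[𝓝 p.1]
        fun s => E (s, p.2.1, u (s, p.2.1)) := by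
      filter_upwards [eventually_mem_fst hs hpS] with s hq using hQ hq
    rw [confDeriv_congr h1, confDeriv_graph_fst hΩo sE (hΩ' hpS) ht (hut _ _ hpD), hup]
    simp only [Prod.mk.eta]
    ring
  have e2 : ∀ {y : ℝ}, ((0 : ℝ), p.1, y) ∈ S → confDeriv α (fun y => pd (1, 0, 0) U (0, p.1, y)) y =
      dY α E (p.1, y, u (p.1, y)) + G (u (p.1, y)) * dU E (p.1, y, u (p.1, y)) := by
    intro y hy
    have h1 : (fun y => pd (1, 0, 0) U (0, p.1, y)) =ᶠ[𝓝 y]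
        fun y => E (p.1, y, u (p.1, y)) := by
      filter_upwards [eventually_mem_snd hs hy] with s hq using hQ hq
    rw [confDeriv_congr h1, confDeriv_graph_snd hΩo sE (hΩ' hy) (pos hy).2 (hux _ _ (hD' hy))]
  have sF : ContDiffOn ℝ ∞ (fun q => dY α E q + G q.2.2 * dU E q) Ω :=
    (contDiffOn_dY hΩo hΩ sE).add
      (((contDiff_waveRate a b c p.2.2 P).comp (contDiff_snd.comp contDiff_snd)).contDiffOn.mul
        (contDiffOn_pd hΩo sE _))
  have e3 : confDeriv α (fun y => confDeriv α (fun z => pd (1, 0, 0) U (0, p.1, z)) y) p.2.1 =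
      dY α (fun q => dY α E q + G q.2.2 * dU E q) p
        + G p.2.2 * dU (fun q => dY α E q + G q.2.2 * dU E q) p := by
    have h1 : (fun y => confDeriv α (fun z => pd (1, 0, 0) U (0, p.1, z)) y) =ᶠ[𝓝 p.2.1]
        fun y => (fun q : ℝ × ℝ × ℝ => dY α E q + G q.2.2 * dU E q) (p.1, y, u (p.1, y)) := by
      filter_upwards [eventually_mem_snd hs hpS] with s hq using e2 hq
    rw [confDeriv_congr h1, confDeriv_graph_snd hΩo sF (hΩ' hpS) hx (hux _ _ hpD), hup]
  have e4 : confDeriv α (fun y => U (0, p.1, y)) p.2.1 = G p.2.2 := by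
    have h1 : (fun y => U (0, p.1, y)) =ᶠ[𝓝 p.2.1] fun y => u (p.1, y) := by
      filter_upwards [eventually_mem_snd hs hpS] with s hq using (hU0 _ hq.1).2.1
    have e : p.2.1 ^ (1 - α) * p.2.1 ^ (α - 1) = 1 := by
      rw [← Real.rpow_add hx]
      simp
    rw [confDeriv_congr h1, confDeriv_eq_of_hasDerivAt (hux _ _ hpD), hup]
    linear_combination G p.2.2 * e
  rw [e1, e2 hpS, e3, e4, (hU0 _ hpS.1).2.1, hQ hpS, hup] at lin
  have fin := linearized_waveCharacteristic (α := α) (β := β) sT sX sη hΩo hp hb hΩ hG hE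
  -- The normalization of G makes its value at the base point the free slope P.
  have hGP : G p.2.2 = P := waveRate_self a b c p.2.2 P
  rw [hGP] at fin lin
  exact fin.symm.trans lin

theorem generatesSymmetries_iff {α β a b : ℝ} (hα : 0 < α) (hβ : 0 < β) (ha : a ≠ 0) (hb : b ≠ 0)
    {Ω : Set (ℝ × ℝ × ℝ)} (hΩo : IsOpen Ω) (hΩc : IsConnected Ω)
    (hΩ : ∀ p ∈ Ω, 0 < p.1 ∧ 0 < p.2.1) (V : ℝ × ℝ × ℝ → ℝ × ℝ × ℝ) :
    GeneratesSymmetries α β a b Ω V ↔ ∃ c₁ c₂ c₃ : ℝ, EqOn V (symField α β c₁ c₂ c₃) Ω :=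
  ⟨fun h => exists_symField_of_vanishesOnWaves hα hβ ha hb hΩo hΩc hΩ h.1
    (h.vanishesOnWaves hα hβ hb hΩo hΩ), fun ⟨_, _, _, h⟩ =>
      generatesSymmetries_of_eqOn hα hβ hΩo hΩ h⟩

/-! ### The Lie algebra of symmetries -/

/-- Each component depends only on its own coordinate, so the Jacobians are diagonal. The scaling
parts commute with one another, and scaling with translation gives a translation. -/
lemma lieBracket_symField {α β c₁ c₂ c₃ d₁ d₂ d₃ : ℝ} (hα : 0 < α) (hβ : 0 < β) {p : ℝ × ℝ × ℝ}
    (ht : 0 < p.1) (hx : 0 < p.2.1) :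
    VectorField.lieBracket ℝ (symField α β c₁ c₂ c₃) (symField α β d₁ d₂ d₃) p =
      symField α β 0 (4 * (c₁ * d₂ - c₂ * d₁)) (2 * (c₁ * d₃ - c₃ * d₁)) p := by
  have h : ∀ c₁ c₂ c₃ : ℝ, ∀ v, fderiv ℝ (symField α β c₁ c₂ c₃) p v =
      ((-4 * c₁ / β + c₂ * ((1 - β) * p.1 ^ (1 - β) / p.1)) * v.1,
        (-2 * c₁ / α + c₃ * ((1 - α) * p.2.1 ^ (1 - α) / p.2.1)) * v.2.1, c₁ * v.2.2) := by
    intro c₁ c₂ c₃ v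
    have h1 : HasFDerivAt (fun q : ℝ × ℝ × ℝ => q.2.1)
        ((ContinuousLinearMap.fst ℝ ℝ ℝ).comp (ContinuousLinearMap.snd ℝ ℝ (ℝ × ℝ))) p :=
      ((ContinuousLinearMap.fst ℝ ℝ ℝ).comp (ContinuousLinearMap.snd ℝ ℝ (ℝ × ℝ))).hasFDerivAt
    have h2 : HasFDerivAt (symField α β c₁ c₂ c₃) _ p :=
      (((hasFDerivAt_fst.const_mul (-4 * c₁)).mul_const β⁻¹).add
        ((hasFDerivAt_rpow_fst (1 - β) ht).const_mul c₂)).prodMk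
        ((((h1.const_mul (-2 * c₁)).mul_const α⁻¹).add
          ((hasFDerivAt_rpow_snd (1 - α) hx).const_mul c₃)).prodMk
          ((hasFDerivAt_snd_snd p).const_mul c₁))
    rw [h2.fderiv]
    ext <;> simp <;> ring
  rw [VectorField.lieBracket, h, h]
  ext
  · simp [symField]
    field_simp
    ring
  · simp [symField]
    field_simp
    ring
  · simp [symField]
    ring

lemma V₁_eq_symField (α β : ℝ) : V₁ β = symField α β 0 1 0 := by
  funext p
  simp [V₁, symField]

lemma V₂_eq_symField (α β : ℝ) : V₂ α = symField α β 0 0 1 := by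
  funext p
  simp [V₂, symField]

lemma V₃_eq_symField (α β : ℝ) : V₃ α β = symField α β (-1) 0 0 := by
  funext p
  simp [V₃, symField]

lemma symField_eq_combination (α β c₁ c₂ c₃ : ℝ) (p : ℝ × ℝ × ℝ) :
    symField α β c₁ c₂ c₃ p = c₂ • V₁ β p + c₃ • V₂ α p + (-c₁) • V₃ α β p := by
  ext
  · simp [symField, V₁, V₂, V₃]
    ring
  · simp [symField, V₁, V₂, V₃]
    ring
  · simp [symField, V₁, V₂, V₃]

lemma linearIndependent_V {α β : ℝ} {Ω : Set (ℝ × ℝ × ℝ)} (hΩo : IsOpen Ω) (hΩn : Ω.Nonempty)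
    (hΩ : ∀ p ∈ Ω, 0 < p.1 ∧ 0 < p.2.1) :
    LinearIndependent ℝ ![Ω.domRestrict (V₁ β), Ω.domRestrict (V₂ α),
      Ω.domRestrict (V₃ α β)] := by
  rw [Fintype.linearIndependent_iff]
  intro g hg
  have h : ∀ p ∈ Ω, g 0 • V₁ β p + g 1 • V₂ α p + g 2 • V₃ α β p = 0 := fun p hp => by
    have h1 := congrFun hg ⟨p, hp⟩
    simpa [Fin.sum_univ_three] using h1
  obtain ⟨p, hp⟩ := hΩn
  -- The third component gives u g₂ = 0 on Ω; differentiating in u removes the factor even where u =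
  -- 0.
  have g2 : g 2 = 0 := by
    have h1 : ∀ q ∈ Ω, q.2.2 * g 2 = 0 := fun q hq => by
      have h2 := congrArg (fun z : ℝ × ℝ × ℝ => z.2.2) (h q hq)
      simp [V₁, V₂, V₃] at h2
      rcases h2 with h2 | h2 <;> simp [h2]
    have h2 := deriv_line_eq_zero hΩo h1 hp (0, 0, 1) ((hasDerivAt_line_u p).mul_const (g 2))
    rwa [one_mul] at h2
  have hp0 := h p hp
  rw [g2] at hp0
  have hA := (Real.rpow_pos_of_pos (hΩ p hp).1 (1 - β)).ne'
  have hB := (Real.rpow_pos_of_pos (hΩ p hp).2 (1 - α)).ne'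
  have e0 := congrArg (fun z : ℝ × ℝ × ℝ => z.1) hp0
  have e1 := congrArg (fun z : ℝ × ℝ × ℝ => z.2.1) hp0
  simp [V₁, V₂, V₃, hA] at e0
  simp [V₁, V₂, V₃, hB] at e1
  intro i
  fin_cases i
  · exact e0
  · exact e1
  · exact g2

end ConformableBurgers

/-! ### The classification and the Lie algebra -/

theorem mainTheorem4 (α β a b : ℝ) (hα : 0 < α) (hα' : α ≤ 1) (hβ : 0 < β) (hβ' : β ≤ 1)
    (ha : a ≠ 0) (hb : b ≠ 0) (Ω : Set (ℝ × ℝ × ℝ)) (hΩo : IsOpen Ω) (hΩc : IsConnected Ω)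
    (hΩ : ∀ p ∈ Ω, 0 < p.1 ∧ 0 < p.2.1) :
    -- the vector fields that generate symmetries
    (∀ V : ℝ × ℝ × ℝ → ℝ × ℝ × ℝ,
      ConformableBurgers.GeneratesSymmetries α β a b Ω V ↔
        ∃ c₁ c₂ c₃ : ℝ, ∀ t x u : ℝ, (t, x, u) ∈ Ω →
          V (t, x, u) = (-4 * c₁ * t / β + c₂ * t ^ (1 - β),
            -2 * c₁ * x / α + c₃ * x ^ (1 - α), c₁ * u)) ∧
    -- the solutions of the infinitesimal criterion
    (∀ V : ℝ × ℝ × ℝ → ℝ × ℝ × ℝ,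
      ConformableBurgers.LieCondition α β a b Ω V ↔
        ∃ c₁ c₂ c₃ : ℝ, ∀ t x u : ℝ, (t, x, u) ∈ Ω →
          V (t, x, u) = (-4 * c₁ * t / β + c₂ * t ^ (1 - β),
            -2 * c₁ * x / α + c₃ * x ^ (1 - α), c₁ * u)) ∧
    -- on `Ω` they form a vector space with basis `V₁, V₂, V₃`
    LinearIndependent ℝ ![Ω.domRestrict (ConformableBurgers.V₁ β),
      Ω.domRestrict (ConformableBurgers.V₂ α), Ω.domRestrict (ConformableBurgers.V₃ α β)] ∧
    {W : Ω → ℝ × ℝ × ℝ | ∃ V : ℝ × ℝ × ℝ → ℝ × ℝ × ℝ,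
        ConformableBurgers.GeneratesSymmetries α β a b Ω V ∧ Ω.domRestrict V = W} =
      (Submodule.span ℝ (Set.range ![Ω.domRestrict (ConformableBurgers.V₁ β),
        Ω.domRestrict (ConformableBurgers.V₂ α), Ω.domRestrict (ConformableBurgers.V₃ α β)]) :
          Set (Ω → ℝ × ℝ × ℝ)) ∧
    -- closed under the Lie bracket
    (∀ V W : ℝ × ℝ × ℝ → ℝ × ℝ × ℝ,
      ConformableBurgers.GeneratesSymmetries α β a b Ω V →
      ConformableBurgers.GeneratesSymmetries α β a b Ω W →
      ConformableBurgers.GeneratesSymmetries α β a b Ω (VectorField.lieBracket ℝ V W)) ∧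
    -- the commutation relations
    (∀ p ∈ Ω,
      VectorField.lieBracket ℝ (ConformableBurgers.V₁ β) (ConformableBurgers.V₂ α) p = 0 ∧
      VectorField.lieBracket ℝ (ConformableBurgers.V₁ β) (ConformableBurgers.V₃ α β) p =
        (4 : ℝ) • ConformableBurgers.V₁ β p ∧
      VectorField.lieBracket ℝ (ConformableBurgers.V₂ α) (ConformableBurgers.V₃ α β) p =
        (2 : ℝ) • ConformableBurgers.V₂ α p) := by
  have form : ∀ V : ℝ × ℝ × ℝ → ℝ × ℝ × ℝ,
      (∃ c₁ c₂ c₃ : ℝ, EqOn V (ConformableBurgers.symField α β c₁ c₂ c₃) Ω) ↔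
        ∃ c₁ c₂ c₃ : ℝ, ∀ t x u : ℝ, (t, x, u) ∈ Ω →
          V (t, x, u) = (-4 * c₁ * t / β + c₂ * t ^ (1 - β),
            -2 * c₁ * x / α + c₃ * x ^ (1 - α), c₁ * u) := fun V =>
    ⟨fun ⟨c₁, c₂, c₃, h⟩ => ⟨c₁, c₂, c₃, fun t x u hp => h hp⟩,
      fun ⟨c₁, c₂, c₃, h⟩ => ⟨c₁, c₂, c₃, fun p hp => h p.1 p.2.1 p.2.2 hp⟩⟩
  have gen := ConformableBurgers.generatesSymmetries_iff hα hβ ha hb hΩo hΩc hΩ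
  refine ⟨fun V => (gen V).trans (form V), fun V =>
    (ConformableBurgers.lieCondition_iff hα hβ ha hb hΩo hΩc hΩ V).trans (form V),
    ConformableBurgers.linearIndependent_V hΩo hΩc.nonempty hΩ, ?_, fun V W hV hW => ?_,
    fun p hp => ?_⟩
  · ext W
    rw [SetLike.mem_coe, Submodule.mem_span_range_iff_exists_fun]
    constructor
    · rintro ⟨V, hV, rfl⟩
      obtain ⟨c₁, c₂, c₃, h⟩ := (gen V).1 hV
      -- The sign reflects that V₃ has parameters (-1, 0, 0).
      refine ⟨![c₂, c₃, -c₁], ?_⟩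
      funext p
      rw [Set.domRestrict_apply, h p.2, ConformableBurgers.symField_eq_combination]
      simp [Fin.sum_univ_three]
    · rintro ⟨g, rfl⟩
      refine ⟨ConformableBurgers.symField α β (-g 2) (g 0) (g 1),
        (gen _).2 ⟨_, _, _, fun p _ => rfl⟩, ?_⟩
      funext p
      rw [Set.domRestrict_apply, ConformableBurgers.symField_eq_combination]
      simp [Fin.sum_univ_three]
  · obtain ⟨c₁, c₂, c₃, hc⟩ := (gen V).1 hV
    obtain ⟨d₁, d₂, d₃, hd⟩ := (gen W).1 hW
    refine (gen _).2 ⟨0, 4 * (c₁ * d₂ - c₂ * d₁), 2 * (c₁ * d₃ - c₃ * d₁), fun p hp => ?_⟩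
    rw [← ConformableBurgers.lieBracket_symField hα hβ (hΩ p hp).1 (hΩ p hp).2]
    -- The bracket at a point depends only on the germs of the fields, and Ω is open.
    exact (hc.eventuallyEq_of_mem (hΩo.mem_nhds hp)).lieBracket_vectorField_eq
      (hd.eventuallyEq_of_mem (hΩo.mem_nhds hp))
  · obtain ⟨ht, hx⟩ := hΩ p hp
    rw [ConformableBurgers.V₁_eq_symField α β, ConformableBurgers.V₂_eq_symField α β,
      ConformableBurgers.V₃_eq_symField α β]
    simp only [ConformableBurgers.lieBracket_symField hα hβ ht hx]
    refine ⟨?_, ?_, ?_⟩ <;> simp [ConformableBurgers.symField]
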